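/- Let $\mu>0$ and let $\Phi:\mathbb{R}_+\to\mathbb{R}_+$ be integrable with $\|\Phi\|_1=\int_0^\infty\Phi(u)\,du<1$. Let $\Phi_1=\Phi$, $\Phi_n(t)=\int_0^t\Phi(t-s)\Phi_{n-1}(s)\,ds$ for $n\ge 2$, and $\Psi=\sum_{n\ge1}\Phi_n$ (the series converges almost everywhere and in $L^1(\mathbb{R}_+)$). Let $(\Omega,\mathcal F,\mathbb P,(\mathcal F_t)_{t\ge0})$ be a filtered probability space and let $(H_t)_{t\ge 0}$ be a Hawkes process with parameters $\mu,\Phi$: an adapted counting process (integer-valued, right-continuous, nondecreasing, with jumps of size one) with $H_0=0$ a.s., $\mathbb E[H_t]<\infty$ for all $t\ge 0$, and intensity $$\lambda_t=\mu+\int_{(0,t)}\Phi(t-s)\,dH_s,\qquad t\ge0,$$ that is, $\mathbb E[\mathbf 1_A(H_t-H_s)]=\mathbb E\big[\int_{(s,t]}\mathbf 1_A\lambda_r\,dr\big]$ for all $0\le s\le t$ and $A\in\mathcal F_s$. Then for every $t\ge0$, $H_t$ and $\lambda_t$ are integrable and $$\mathbb E[H_t]=\mu\int_0^t\Big(1+\int_0^u\Psi(r)\,dr\Big)du,\qquad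 \mathbb E[\lambda_t]=\mu\Big(1+\int_0^t\Psi(r)\,dr\Big).$$ Moreover, for all $0\le s\le t$, with $\mathrm{Cov}(X,Y)=\mathbb E[XY]-\mathbb E[X]\,\mathbb E[Y]$: (i) $H_sH_t$ is integrable and $$\mathrm{Cov}(H_s,H_t)=\mu\int_0^s\Big(1+\int_0^v\Psi(w)\,dw\Big)\Big(1+\int_v^s\Psi(y-v)\,dy\Big)\Big(1+\int_v^t\Psi(y-v)\,dy\Big)dv.$$ (ii) In $[0,\infty]$, $$\mathbb E[\lambda_s\lambda_t]=\mathbb E[\lambda_s]\,\mathbb E[\lambda_t]+\mu\int_0^s\Psi(s-v)\Psi(t-v)\Big(1+\int_0^v\Psi(v-w)\,dw\Big)dv.$$ In particular $\lambda_s\lambda_t$ is integrable if and only if the integral on the right is finite, and in this case $$\mathrm{Cov}(\lambda_s,\lambda_t)=\mu\int_0^s\Psi(s-v)\Psi(t-v)\Big(1+\int_0^v\Psi(v-w)\,dw\Big)dv.$$ (iii) $\lambda_sH_t$ and $H_s\lambda_t$ are integrable and $$\mathrm{Cov}(\lambda_s,H_t)=\mu\int_0^s\Psi(s-v)\Big(1+\int_0^v\Psi(w)\,dw\Big)\Big(1+\int_v^t\Psi(y-v)\,dy\Big)dv,$$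 $$\mathrm{Cov}(H_s,\lambda_t)=\mu\int_0^s\Psi(t-v)\Big(1+\int_0^v\Psi(w)\,dw\Big)\Big(1+\int_v^s\Psi(y-v)\,dy\Big)dv.$$ -/

import Mathlib

open MeasureTheory ProbabilityTheory Set
open scoped NNReal ENNReal

/-- The assumption on the excitation kernel: `Φ` is nonnegative and integrable on `[0, ∞)`, with
`∫₀^∞ Φ < 1`. (The values of `Φ` on the negative half-line are never used.) -/
structure IsExcitationKernel (Φ : ℝ → ℝ) : Prop where
  nonneg : ∀ u, 0 ≤ u → 0 ≤ Φ u
  integrableOn : IntegrableOn Φ (Ici 0)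
  integral_lt_one : ∫ u in Ici (0 : ℝ), Φ u < 1

/-- Iterated convolutions of `Φ` on `[0, ∞)`, numbered from `0`: `iterConv Φ 0 = Φ` and
`iterConv Φ (n + 1) (t) = ∫₀ᵗ Φ (t - s) * iterConv Φ n (s) ds`, so that `iterConv Φ n` is the
`(n + 1)`-fold convolution power of `Φ`. -/
noncomputable def iterConv (Φ : ℝ → ℝ) : ℕ → ℝ → ℝ
  | 0 => Φ
  | n + 1 => fun t => ∫ s in (0 : ℝ)..t, Φ (t - s) * iterConv Φ n s

/-- `Ψ`, the sum of all iterated convolutions of `Φ`. For an excitation kernel `Φ` the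
series has nonnegative terms and converges at almost every `t ≥ 0` and in `L¹(0, ∞)`. -/
noncomputable def hawkesPsi (Φ : ℝ → ℝ) (t : ℝ) : ℝ := ∑' n, iterConv Φ n t

/-- Paths of counting processes: nondecreasing, right-continuous, with jumps of size one. -/
structure IsCountingPath (h : ℝ≥0 → ℕ) : Prop where
  monotone : Monotone h
  rightContinuous : ∀ t, ContinuousWithinAt h (Ici t) t
  unitJump : ∀ t, 0 < t → ∃ s < t, h t ≤ h s + 1

/-- The jump times of a path. -/
def jumpTimes (h : ℝ≥0 → ℕ) : Set ℝ≥0 := {u | 0 < u ∧ ∀ r < u, h r < h u}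

/-- The process `λ_t = μ + ∫_{(0,t)} Φ (t - u) dH_u`. As the path of `H` is that of a counting
process, the integral is the (finite) sum over the jump times of `H` in `(0,t)`. -/
noncomputable def hawkesIntensity {Ω : Type*} (μ : ℝ) (Φ : ℝ → ℝ) (H : ℝ≥0 → Ω → ℕ)
    (t : ℝ) (ω : Ω) : ℝ :=
  μ + ∑ᶠ u ∈ {u : ℝ≥0 | u ∈ jumpTimes (fun r => H r ω) ∧ (u : ℝ) < t}, Φ (t - u)

/-- `H` is a Hawkes process with parameters `μ` and `Φ` on the filtered probability space
`(Ω, ℱ, P)`: an adapted counting process, with `H_0 = 0` almost surely, such that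
`E[1_A (H_t - H_s)] = E[∫_{(s,t]} 1_A λ_r dr]` for all `s ≤ t` and `A ∈ ℱ_s`.
The expectations in this identity are meant to be finite (an identity between infinite
expectations would carry no information), which is the field `integrable`. -/
structure IsHawkesProcess {Ω : Type*} {mΩ : MeasurableSpace Ω} (P : Measure Ω)
    (ℱ : Filtration ℝ≥0 mΩ) (μ : ℝ) (Φ : ℝ → ℝ) (H : ℝ≥0 → Ω → ℕ) : Prop where
  adapted : Adapted ℱ H
  countingPath : ∀ ω, IsCountingPath (fun t => H t ω)
  zero : ∀ᵐ ω ∂P, H 0 ω = 0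
  integrable : ∀ t, Integrable (fun ω => (H t ω : ℝ)) P
  intensity : ∀ s t : ℝ≥0, s ≤ t → ∀ A : Set Ω, MeasurableSet[ℱ s] A →
    ∫⁻ ω in A, ((H t ω - H s ω : ℕ) : ℝ≥0∞) ∂P =
      ∫⁻ ω in A, (∫⁻ r in Ioc (s : ℝ) t, ENNReal.ofReal (hawkesIntensity μ Φ H r ω)) ∂P

/-! Write N for the jump measure of the path, c for `μ` seen in `[0, ∞]`, φ for a Borel version of
the kernel that vanishes on `(-∞, 0]`, and ψ for the sum of its convolution powers. Both quantities
of interest are affine in N: H_t is N(g) with g the indicator of `(-∞, t]`, and λ_t is c + N(g) with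
g = φ(t - ·). So it is enough to know the first and mixed second moments of N(g).

Let A be the compensator, with density λ on `(0, ∞)`. Since λ is itself affine in N, A(f) = c∫f +
N(∫ f(u) φ(u - ·) du). Choose f = Rg (`renewalTransform`) solving f(v) = g(v) + ∫ f(u) φ(u - v) du,
explicitly f(v) = g(v) + ∫ g(y) ψ(y - v) dy. Then N(g) = c∫f + (N - A)(f): a constant plus a
compensated integral of a deterministic function. Hence E N(g) = c∫Rg, and the covariance of N(g)
and N(k) is E[(N - A)(Rg) (N - A)(Rk)] = E N(Rg Rk) = c∫ Rg Rk ρ, where ρ(v) = 1 + ∫₀ᵛ ψ. For the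
two kinds of g above, Rg is 1 + ∫₀^{t-v} ψ on `(-∞, t]` and ψ(t - v) respectively, which gives all
the formulas.

The compensation formula E N(F) = E A(F) for predictable F
(`lintegral_jumpMeasure_eq_intensityMeasure`) comes from the definition of the intensity by a π-λ
argument. The isometry (`lintegral_mul_add_lintegral_mul`) follows by splitting products along the
diagonal. All of this is done in `[0, ∞]` with every term moved to the side where it is positive, so
that cancelling requires finite second moments. These are obtained in
`lintegral_sq_jumpMeasure_Iic_ne_top` from the contraction A(F) ≤ b + q N(F), q = ∫φ < 1, for
integrands F that switch off after finitely many jumps. Unbounded g, needed for λ, are reached by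
truncation; this yields the identity for E[λ_s λ_t] even when it is infinite. -/

/-! ### Counting paths, passage times and the jump measure. -/

/-- The path `h` passes from at most `k` to more than `k` at some positive time. -/
def PassesLevel (h : ℝ≥0 → ℕ) (k : ℕ) : Prop := h 0 ≤ k ∧ ∃ t, k < h t

/-- The first time at which the path exceeds `k`. -/
noncomputable def passageTime (h : ℝ≥0 → ℕ) (k : ℕ) : ℝ≥0 := sInf {t | k < h t}

open Classical in
/-- The jump measure of a counting path, as a measure on `ℝ`. -/
noncomputable def jumpMeasure (h : ℝ≥0 → ℕ) : Measure ℝ :=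
  Measure.sum fun k => if PassesLevel h k then Measure.dirac (passageTime h k : ℝ) else 0

namespace IsCountingPath

variable {h : ℝ≥0 → ℕ}

/-- By right-continuity an integer-valued path is constant just after each time, so the infimum
defining the passage time is attained. -/
lemma lt_passageTime_value (hh : IsCountingPath h) {k : ℕ} (hk : ∃ t, k < h t) :
    k < h (passageTime h k) := by
  by_contra hcon
  have hc := hh.rightContinuous (passageTime h k)
  have : ∀ᶠ t in nhdsWithin (passageTime h k) (Ici (passageTime h k)),
      h t = h (passageTime h k) := by
    have := hc (IsOpen.mem_nhds (isOpen_discrete {h (passageTime h k)}) rfl)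
    exact this
  rw [eventually_nhdsWithin_iff, Metric.eventually_nhds_iff] at this
  obtain ⟨ε, hε, hball⟩ := this
  obtain ⟨t, ht, htlt⟩ := exists_lt_of_csInf_lt (s := {t | k < h t}) hk
    (show sInf {t | k < h t} < passageTime h k + ⟨ε, hε.le⟩ from
      lt_add_of_pos_right _ (by exact hε))
  have hle : passageTime h k ≤ t := csInf_le (OrderBot.bddBelow _) ht
  have := hball (y := t) (by
    rw [NNReal.dist_eq, abs_lt]
    have h1 : (t : ℝ) < passageTime h k + ε := by exact_mod_cast htlt
    have h2 : (passageTime h k : ℝ) ≤ t := by exact_mod_cast hle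
    constructor <;> linarith) hle
  have ht' : k < h t := ht
  omega

lemma passageTime_le_iff (hh : IsCountingPath h) {k : ℕ} (hk : ∃ t, k < h t) (t : ℝ≥0) :
    passageTime h k ≤ t ↔ k < h t :=
  ⟨fun hle => (hh.lt_passageTime_value hk).trans_le (hh.monotone hle),
    fun hlt => csInf_le (OrderBot.bddBelow _) hlt⟩

lemma coe_passageTime_pos (hh : IsCountingPath h) {k : ℕ} (hk : PassesLevel h k) :
    (0 : ℝ) < passageTime h k := by
  rw [NNReal.coe_pos]
  by_contra hcon
  have := (hh.passageTime_le_iff hk.2 0).1 (not_lt.1 hcon)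
  have := hk.1
  omega

lemma coe_passageTime_le_iff (hh : IsCountingPath h) {k : ℕ} (hk : PassesLevel h k) (t : ℝ) :
    (passageTime h k : ℝ) ≤ t ↔ k < h t.toNNReal := by
  rcases le_total 0 t with ht | ht
  · rw [← hh.passageTime_le_iff hk.2, ← NNReal.coe_le_coe, Real.coe_toNNReal _ ht]
  · have h1 := hh.coe_passageTime_pos hk
    have h2 := hk.1
    rw [Real.toNNReal_of_nonpos ht]
    constructor
    · intro; linarith
    · intro; omega

/-- The only use of unit jumps. It makes passage times of different levels distinct, hence every
atom of the jump measure has mass one. -/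
lemma apply_passageTime (hh : IsCountingPath h) {k : ℕ} (hk : PassesLevel h k) :
    h (passageTime h k) = k + 1 := by
  have h1 := hh.lt_passageTime_value hk.2
  obtain ⟨s, hs, hle⟩ := hh.unitJump (passageTime h k)
    (by exact_mod_cast hh.coe_passageTime_pos hk)
  have : ¬ k < h s := fun hlt => absurd ((hh.passageTime_le_iff hk.2 s).2 hlt) (not_le.2 hs)
  omega

lemma passageTime_injOn (hh : IsCountingPath h) : InjOn (passageTime h) {k | PassesLevel h k} := by
  intro k hk j hj hkj
  have h1 := hh.apply_passageTime hk
  have h2 := hh.apply_passageTime hj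
  rw [hkj] at h1
  omega

lemma passageTime_mem_jumpTimes (hh : IsCountingPath h) {k : ℕ} (hk : PassesLevel h k) :
    passageTime h k ∈ jumpTimes h := by
  refine ⟨by exact_mod_cast hh.coe_passageTime_pos hk, fun r hr => ?_⟩
  rw [hh.apply_passageTime hk]
  have : ¬ k < h r := fun hlt => absurd ((hh.passageTime_le_iff hk.2 r).2 hlt) (not_le.2 hr)
  omega

lemma exists_eq_passageTime (hh : IsCountingPath h) {u : ℝ≥0} (hu : u ∈ jumpTimes h) :
    ∃ k, PassesLevel h k ∧ passageTime h k = u := by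
  have h0 := hu.2 0 hu.1
  have hk : PassesLevel h (h u - 1) := ⟨by omega, u, by omega⟩
  refine ⟨h u - 1, hk, le_antisymm ((hh.passageTime_le_iff hk.2 u).2 (by omega)) ?_⟩
  by_contra hcon
  have h1 := hu.2 _ (not_le.1 hcon)
  have h2 := hh.apply_passageTime hk
  omega

lemma ae_jumpMeasure_pos (hh : IsCountingPath h) : ∀ᵐ v ∂jumpMeasure h, 0 < v := by
  rw [jumpMeasure, Measure.ae_sum_iff]
  intro k
  split_ifs with hk
  · rw [ae_dirac_iff measurableSet_Ioi]
    exact hh.coe_passageTime_pos hk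
  · simp

end IsCountingPath

open Classical in
lemma lintegral_jumpMeasure (h : ℝ≥0 → ℕ) (f : ℝ → ℝ≥0∞) :
    ∫⁻ v, f v ∂jumpMeasure h
      = ∑' k, if PassesLevel h k then f (passageTime h k) else 0 := by
  rw [jumpMeasure, lintegral_sum_measure]
  congr 1 with k
  split_ifs <;> simp

instance (h : ℝ≥0 → ℕ) : SFinite (jumpMeasure h) := by
  classical
  unfold jumpMeasure
  have : ∀ k, SFinite (if PassesLevel h k then Measure.dirac (passageTime h k : ℝ) else 0) := by
    intro k; split_ifs <;> infer_instance
  infer_instance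

namespace IsCountingPath

variable {h : ℝ≥0 → ℕ}

lemma jumpMeasure_Ioc (hh : IsCountingPath h) (s t : ℝ) :
    jumpMeasure h (Ioc s t) = (h t.toNNReal - h s.toNNReal : ℕ) := by
  classical
  rw [← lintegral_indicator_one measurableSet_Ioc, lintegral_jumpMeasure]
  have : ∀ k, (if PassesLevel h k then (Ioc s t).indicator (1 : ℝ → ℝ≥0∞) (passageTime h k) else 0)
      = if k ∈ Finset.Ico (h s.toNNReal) (h t.toNNReal) then 1 else 0 := by
    intro k
    by_cases hk : PassesLevel h k
    · simp only [hk, if_true, indicator_apply, mem_Ioc, Finset.mem_Ico, Pi.one_apply]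
      refine if_congr ?_ rfl rfl
      rw [hh.coe_passageTime_le_iff hk, ← not_le, hh.coe_passageTime_le_iff hk, not_lt]
    · rw [if_neg hk, if_neg]
      intro hmem
      rw [Finset.mem_Ico] at hmem
      exact hk ⟨(hh.monotone zero_le).trans hmem.1, _, hmem.2⟩
  simp_rw [this]
  rw [tsum_eq_sum (s := Finset.Ico (h s.toNNReal) (h t.toNNReal)) (fun k hk => if_neg hk),
    Finset.sum_congr rfl (fun k hk => if_pos hk)]
  simp

lemma jumpMeasure_singleton (hh : IsCountingPath h) {k : ℕ} (hk : PassesLevel h k) :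
    jumpMeasure h {(passageTime h k : ℝ)} = 1 := by
  classical
  rw [← lintegral_indicator_one (measurableSet_singleton _), lintegral_jumpMeasure,
    tsum_eq_single k]
  · simp [hk]
  · intro j hj
    split_ifs with hj'
    · rw [indicator_of_notMem]
      intro hmem
      exact hj (hh.passageTime_injOn hj' hk (by simpa using hmem))
    · rfl

/-- All atoms have mass one. This evaluates the diagonal term in the square of a jump integral. -/
lemma lintegral_mul_jumpMeasure_singleton (hh : IsCountingPath h) (f : ℝ → ℝ≥0∞) :
    ∫⁻ v, f v * jumpMeasure h {v} ∂jumpMeasure h = ∫⁻ v, f v ∂jumpMeasure h := by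
  rw [lintegral_jumpMeasure, lintegral_jumpMeasure]
  congr 1 with k
  split_ifs with hk
  · rw [hh.jumpMeasure_singleton hk, mul_one]
  · rfl

/-- The finite sum over the jump times before `t` is an integral against the jump measure. -/
lemma ofReal_finsum_jumpTimes (hh : IsCountingPath h) {Φ : ℝ → ℝ} (hΦ : ∀ u, 0 ≤ u → 0 ≤ Φ u)
    {φ : ℝ → ℝ≥0∞} (hφ : ∀ u ≤ 0, φ u = 0) {t : ℝ}
    (hφΦ : ∀ k, PassesLevel h k → passageTime h k < t →
      φ (t - passageTime h k) = ENNReal.ofReal (Φ (t - passageTime h k))) :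
    0 ≤ ∑ᶠ u ∈ {u : ℝ≥0 | u ∈ jumpTimes h ∧ (u : ℝ) < t}, Φ (t - u) ∧
    ENNReal.ofReal (∑ᶠ u ∈ {u : ℝ≥0 | u ∈ jumpTimes h ∧ (u : ℝ) < t}, Φ (t - u))
      = ∫⁻ v, φ (t - v) ∂jumpMeasure h := by
  classical
  set S : Set ℕ := {k | PassesLevel h k ∧ (passageTime h k : ℝ) < t} with hS
  -- Levels passed before `t` lie below the value of the path at `t`. Finiteness matters: a `finsum`
  -- with infinite support would be zero by default.
  have hfin : S.Finite := by
    refine (Set.finite_Iio (h t.toNNReal)).subset ?_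
    rintro k ⟨hk, hlt⟩
    exact (hh.coe_passageTime_le_iff hk t).1 hlt.le
  have hsum : ∑ᶠ u ∈ {u : ℝ≥0 | u ∈ jumpTimes h ∧ (u : ℝ) < t}, Φ (t - u)
      = ∑ k ∈ hfin.toFinset, Φ (t - passageTime h k) := by
    rw [← finsum_mem_eq_finite_toFinset_sum]
    symm
    refine finsum_mem_eq_of_bijOn (passageTime h) ⟨?_, ?_, ?_⟩ (fun k _ => rfl)
    · rintro k ⟨hk, hlt⟩
      exact ⟨hh.passageTime_mem_jumpTimes hk, hlt⟩
    · exact hh.passageTime_injOn.mono fun k hk => hk.1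
    · rintro u ⟨hu, hlt⟩
      obtain ⟨k, hk, rfl⟩ := hh.exists_eq_passageTime hu
      exact ⟨k, ⟨hk, hlt⟩, rfl⟩
  have hnn : ∀ k ∈ hfin.toFinset, 0 ≤ Φ (t - passageTime h k) := by
    intro k hk
    have := (hfin.mem_toFinset.1 hk).2
    exact hΦ _ (by linarith)
  rw [hsum]
  refine ⟨Finset.sum_nonneg hnn, ?_⟩
  rw [ENNReal.ofReal_sum_of_nonneg hnn, lintegral_jumpMeasure,
    tsum_eq_sum (s := hfin.toFinset)]
  · refine Finset.sum_congr rfl fun k hk => ?_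
    have := hfin.mem_toFinset.1 hk
    rw [if_pos this.1, hφΦ k this.1 this.2]
  · intro k hk
    split_ifs with hk'
    · apply hφ
      have : ¬ ((passageTime h k : ℝ) < t) := fun hlt => hk (hfin.mem_toFinset.2 ⟨hk', hlt⟩)
      linarith
    · rfl

end IsCountingPath

/-! ### The resolvent of the kernel and the renewal equation. -/

/-- Convolution powers of an extended nonnegative function on `ℝ`, numbered from `0`. -/
noncomputable def convPow (φ : ℝ → ℝ≥0∞) : ℕ → ℝ → ℝ≥0∞
  | 0 => φ
  | n + 1 => fun t => ∫⁻ s, φ (t - s) * convPow φ n s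

/-- The sum of all convolution powers. -/
noncomputable def convResolvent (φ : ℝ → ℝ≥0∞) (t : ℝ) : ℝ≥0∞ := ∑' n, convPow φ n t

/-- The solution `f` of the equation `f v = g v + ∫ f u * φ (u - v) du`. -/
noncomputable def renewalTransform (φ g : ℝ → ℝ≥0∞) (v : ℝ) : ℝ≥0∞ :=
  g v + ∫⁻ y, g y * convResolvent φ (y - v)

/-- The density `1 + ∫_{v > 0} ψ (y - v) dv`, where `ψ` is the resolvent of `φ`. -/
noncomputable def renewalDensity (φ : ℝ → ℝ≥0∞) (y : ℝ) : ℝ≥0∞ :=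
  1 + ∫⁻ v in Ioi (0 : ℝ), convResolvent φ (y - v)

section Resolvent

variable {φ : ℝ → ℝ≥0∞}

lemma measurable_convPow (hφ : Measurable φ) (n : ℕ) : Measurable (convPow φ n) := by
  induction n with
  | zero => exact hφ
  | succ n ih =>
    refine Measurable.lintegral_prod_right' (f := fun p : ℝ × ℝ => φ (p.1 - p.2) * convPow φ n p.2) ?_
    fun_prop

lemma measurable_convResolvent (hφ : Measurable φ) : Measurable (convResolvent φ) :=
  Measurable.tsum fun n => measurable_convPow hφ n

/-- Split off the first term of the series and shift the index of the others. -/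
lemma convResolvent_eq (hφ : Measurable φ) (t : ℝ) :
    convResolvent φ t = φ t + ∫⁻ s, φ (t - s) * convResolvent φ s := by
  have : ∀ s, φ (t - s) * convResolvent φ s = ∑' n, φ (t - s) * convPow φ n s := fun s =>
    ENNReal.tsum_mul_left.symm
  simp_rw [this]
  rw [lintegral_tsum, convResolvent, tsum_eq_zero_add' ENNReal.summable]
  · rfl
  · intro n
    have := measurable_convPow hφ n
    fun_prop

lemma lintegral_convPow (hφ : Measurable φ) (n : ℕ) :
    ∫⁻ t, convPow φ n t = (∫⁻ t, φ t) ^ (n + 1) := by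
  induction n with
  | zero => simp [convPow]
  | succ n ih =>
    have hm := measurable_convPow hφ n
    simp only [convPow]
    rw [lintegral_lintegral_swap (by fun_prop)]
    have h1 : ∀ s, ∫⁻ t, φ (t - s) * convPow φ n s = (∫⁻ t, φ t) * convPow φ n s := fun s => by
      rw [lintegral_mul_const _ (by fun_prop), lintegral_sub_right_eq_self φ]
    simp_rw [h1]
    rw [lintegral_const_mul _ hm, ih, pow_succ' _ (n + 1)]

/-- Masses multiply under convolution, so the total mass is a geometric series with ratio `∫ φ < 1`.
-/
lemma lintegral_convResolvent_lt_top (hφ : Measurable φ) (h1 : ∫⁻ t, φ t < 1) :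
    ∫⁻ t, convResolvent φ t < ∞ := by
  simp only [convResolvent]
  rw [lintegral_tsum fun n => (measurable_convPow hφ n).aemeasurable]
  simp_rw [lintegral_convPow hφ, pow_succ']
  rw [ENNReal.tsum_mul_left, ENNReal.tsum_geometric]
  refine ENNReal.mul_lt_top (h1.trans ENNReal.one_lt_top) ?_
  rw [ENNReal.inv_lt_top]
  exact tsub_pos_of_lt h1

lemma convPow_of_nonpos (h0 : ∀ t ≤ 0, φ t = 0) (n : ℕ) : ∀ t ≤ 0, convPow φ n t = 0 := by
  induction n with
  | zero => exact h0
  | succ n ih =>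
    intro t ht
    simp only [convPow]
    rw [lintegral_eq_zero_of_ae_eq_zero]
    refine ae_of_all _ fun s => ?_
    rcases le_total s 0 with hs | hs
    · simp [ih s hs]
    · simp [h0 (t - s) (by linarith)]

lemma convResolvent_of_nonpos (h0 : ∀ t ≤ 0, φ t = 0) {t : ℝ} (ht : t ≤ 0) : convResolvent φ t = 0 := by
  simp [convResolvent, fun n => convPow_of_nonpos h0 n t ht]

lemma measurable_renewalTransform (hφ : Measurable φ) {g : ℝ → ℝ≥0∞} (hg : Measurable g) :
    Measurable (renewalTransform φ g) := by
  refine hg.add (Measurable.lintegral_prod_right'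
    (f := fun p : ℝ × ℝ => g p.2 * convResolvent φ (p.2 - p.1)) ?_)
  have := measurable_convResolvent hφ
  fun_prop

/-- By Tonelli, the `ψ` part of the transform integrated against `φ (u - v)` is `g` integrated
against `φ * ψ`; adding the `φ` coming from `g` itself recovers `ψ` by the resolvent equation. -/
lemma renewalTransform_eq (hφ : Measurable φ) {g : ℝ → ℝ≥0∞} (hg : Measurable g) (v : ℝ) :
    renewalTransform φ g v = g v + ∫⁻ u, renewalTransform φ g u * φ (u - v) := by
  have hψ := measurable_convResolvent hφ
  have hJ : Measurable fun u => ∫⁻ y, g y * convResolvent φ (y - u) :=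
    Measurable.lintegral_prod_right' (f := fun p : ℝ × ℝ => g p.2 * convResolvent φ (p.2 - p.1))
      (by fun_prop)
  have hswap : ∫⁻ u, (∫⁻ y, g y * convResolvent φ (y - u)) * φ (u - v)
      = ∫⁻ y, g y * ∫⁻ z, φ (y - v - z) * convResolvent φ z := by
    have h1 : ∀ u, (∫⁻ y, g y * convResolvent φ (y - u)) * φ (u - v)
        = ∫⁻ y, g y * convResolvent φ (y - u) * φ (u - v) := fun u =>
      (lintegral_mul_const _ (by fun_prop)).symm
    simp_rw [h1]
    rw [lintegral_lintegral_swap (by fun_prop)]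
    refine lintegral_congr fun y => ?_
    simp_rw [mul_assoc]
    rw [lintegral_const_mul _ (by fun_prop),
      ← lintegral_sub_left_eq_self (fun u => convResolvent φ (y - u) * φ (u - v)) y]
    congr 1
    refine lintegral_congr fun z => ?_
    rw [mul_comm]
    congr 2 <;> ring
  simp only [renewalTransform]
  simp_rw [add_mul]
  rw [lintegral_add_left (by fun_prop), hswap, ← lintegral_add_left (by fun_prop)]
  congr 1
  refine lintegral_congr fun y => ?_
  rw [convResolvent_eq hφ (y - v), mul_add]

lemma renewalTransform_le (hφ : Measurable φ) {g : ℝ → ℝ≥0∞} {c : ℝ≥0∞} (hc : ∀ u, g u ≤ c) (v : ℝ) :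
    renewalTransform φ g v ≤ c * (1 + ∫⁻ t, convResolvent φ t) := by
  rw [mul_add, mul_one]
  refine add_le_add (hc v) ?_
  calc ∫⁻ y, g y * convResolvent φ (y - v) ≤ ∫⁻ y, c * convResolvent φ (y - v) :=
        lintegral_mono fun y => by gcongr; exact hc y
    _ ≤ c * ∫⁻ t, convResolvent φ t := by
        have := measurable_convResolvent hφ
        rw [lintegral_const_mul _ (by fun_prop), lintegral_sub_right_eq_self]

/-- `ψ` vanishes on nonpositive arguments, so the transform at `v` sees only values of `g` after
`v`. -/
lemma renewalTransform_of_lt (h0 : ∀ t ≤ 0, φ t = 0) {g : ℝ → ℝ≥0∞} {T : ℝ}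
    (hg : ∀ u, T < u → g u = 0) {v : ℝ} (hv : T < v) : renewalTransform φ g v = 0 := by
  rw [renewalTransform, hg v hv, zero_add, lintegral_eq_zero_of_ae_eq_zero]
  refine ae_of_all _ fun y => ?_
  rcases le_or_gt y T with hy | hy
  · simp [convResolvent_of_nonpos h0 (show y - v ≤ 0 by linarith)]
  · simp [hg y hy]

lemma measurable_renewalDensity (hφ : Measurable φ) : Measurable (renewalDensity φ) := by
  refine measurable_const.add (Measurable.lintegral_prod_right'
    (f := fun p : ℝ × ℝ => convResolvent φ (p.1 - p.2)) ?_)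
  have := measurable_convResolvent hφ
  fun_prop

/-- Tonelli: `renewalDensity` is the adjoint of the transform applied to the indicator of `(0, ∞)`.
It turns `c ∫ R w` into the mean density of jumps integrated against `w`. -/
lemma lintegral_renewalTransform (hφ : Measurable φ) {g : ℝ → ℝ≥0∞} (hg : Measurable g)
    (hg0 : ∀ u ≤ 0, g u = 0) :
    ∫⁻ v in Ioi (0 : ℝ), renewalTransform φ g v = ∫⁻ y in Ioi (0 : ℝ), g y * renewalDensity φ y := by
  have hψ := measurable_convResolvent hφ
  have hind : ∀ F : ℝ → ℝ≥0∞, ∫⁻ y, g y * F y = ∫⁻ y in Ioi (0 : ℝ), g y * F y := by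
    intro F
    rw [← lintegral_indicator measurableSet_Ioi]
    refine lintegral_congr fun y => ?_
    by_cases hy : y ∈ Ioi (0 : ℝ)
    · rw [indicator_of_mem hy]
    · rw [indicator_of_notMem hy, hg0 y (not_lt.1 hy), zero_mul]
  simp only [renewalTransform, renewalDensity]
  simp_rw [mul_add, mul_one]
  rw [lintegral_add_left hg, lintegral_add_left hg, lintegral_lintegral_swap (by fun_prop), ← hind]
  congr 1
  refine lintegral_congr fun y => ?_
  rw [lintegral_const_mul _ (by fun_prop)]

end Resolvent

/-! ### Borel versions of the kernel, and comparison of their resolvent with `hawkesPsi`. -/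

/-- `φ` is a Borel version of `Φ` on `(0, ∞)`, extended by zero. -/
structure IsBorelVersion (Φ : ℝ → ℝ) (φ : ℝ → ℝ≥0∞) : Prop where
  measurable : Measurable φ
  zero : ∀ t ≤ 0, φ t = 0
  ne_top : ∀ t, φ t ≠ ∞
  ae_eq : ∀ᵐ t, 0 < t → φ t = ENNReal.ofReal (Φ t)
  lintegral_lt_one : ∫⁻ t, φ t < 1

/-- `Φ` is only almost everywhere equal to a measurable function. Setting the version to zero at the
origin as well makes `φ (t - ·)` see only jumps strictly before `t`. -/
lemma IsExcitationKernel.exists_isBorelVersion {Φ : ℝ → ℝ} (hΦ : IsExcitationKernel Φ) :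
    ∃ φ, IsBorelVersion Φ φ := by
  have hint : IntegrableOn Φ (Ioi 0) := hΦ.integrableOn.mono_set Ioi_subset_Ici_self
  obtain ⟨f, hfm, hf⟩ := hint.aestronglyMeasurable
  have hf' : ∀ᵐ t, 0 < t → Φ t = f t := (ae_restrict_iff' measurableSet_Ioi).1 hf
  refine ⟨(Ioi 0).indicator fun t => ENNReal.ofReal (f t), ?_, ?_, ?_, ?_, ?_⟩
  · exact (hfm.measurable.ennreal_ofReal).indicator measurableSet_Ioi
  · intro t ht
    exact indicator_of_notMem (not_lt.2 ht) _
  · intro t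
    rw [indicator_apply]
    split_ifs <;> simp
  · filter_upwards [hf'] with t ht h0
    rw [indicator_of_mem (show t ∈ Ioi (0 : ℝ) from h0), ht h0]
  · rw [lintegral_indicator measurableSet_Ioi]
    have h2 := hΦ.integral_lt_one
    rw [integral_Ici_eq_integral_Ioi, integral_congr_ae hf] at h2
    have hf0 : 0 ≤ᵐ[volume.restrict (Ioi 0)] f := by
      filter_upwards [hf, ae_restrict_mem measurableSet_Ioi] with t ht h0
      simpa [← ht] using hΦ.nonneg t (le_of_lt h0)
    rw [← ofReal_integral_eq_lintegral_ofReal (hint.congr hf) hf0]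
    exact ENNReal.ofReal_lt_one.2 h2

namespace IsBorelVersion

variable {Φ : ℝ → ℝ} {φ : ℝ → ℝ≥0∞}

lemma convPow_lt_top (h : IsBorelVersion Φ φ) (n : ℕ) : ∀ᵐ t, convPow φ n t < ∞ := by
  refine ae_lt_top (measurable_convPow h.measurable n) ?_
  rw [lintegral_convPow h.measurable]
  exact ENNReal.pow_ne_top (h.lintegral_lt_one.trans ENNReal.one_lt_top).ne

lemma iterConv_eq (h : IsBorelVersion Φ φ) (hΦ : ∀ u, 0 ≤ u → 0 ≤ Φ u) (n : ℕ) :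
    ∀ᵐ t, 0 < t → iterConv Φ n t = (convPow φ n t).toReal := by
  induction n with
  | zero =>
    filter_upwards [h.ae_eq] with t ht h0
    simp only [iterConv, convPow]
    rw [ht h0, ENNReal.toReal_ofReal (hΦ t h0.le)]
  | succ n ih =>
    refine ae_of_all _ fun t h0 => ?_
    have hφ := h.measurable
    have hm := measurable_convPow hφ n
    simp only [iterConv, convPow]
    have hrefl : ∀ᵐ s, 0 < t - s → φ (t - s) = ENNReal.ofReal (Φ (t - s)) :=
      (Measure.measurePreserving_sub_left volume t).quasiMeasurePreserving.ae h.ae_eq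
    have hne : ∀ᵐ s, s ≠ t := by simp [ae_iff]
    -- Finiteness of the integrand almost everywhere suffices: if the convolution is infinite at
    -- `t`, the Bochner integral and `toReal` are both zero. The endpoint `s = t` is discarded
    -- because `φ` is compared with `Φ` only at positive arguments.
    rw [intervalIntegral.integral_of_le h0.le,
      integral_congr_ae (g := fun s => (φ (t - s) * convPow φ n s).toReal), integral_toReal]
    · rw [← lintegral_indicator measurableSet_Ioc]
      congr 1
      refine lintegral_congr fun s => ?_
      by_cases hs : s ∈ Ioc 0 t
      · rw [indicator_of_mem hs]
      · rw [indicator_of_notMem hs]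
        rcases le_or_gt s 0 with h1 | h1
        · rw [convPow_of_nonpos h.zero n s h1, mul_zero]
        · rw [h.zero, zero_mul]
          by_contra hcon
          exact hs ⟨h1, by linarith⟩
    · fun_prop
    · refine ae_restrict_of_ae ?_
      filter_upwards [h.convPow_lt_top n] with s hs
      exact ENNReal.mul_lt_top (h.ne_top _).lt_top hs
    · rw [Filter.EventuallyEq, ae_restrict_iff' measurableSet_Ioc]
      filter_upwards [hrefl, ih, hne] with s h1 h2 h3 hs
      have hlt : 0 < t - s := sub_pos.2 (lt_of_le_of_ne hs.2 h3)
      rw [ENNReal.toReal_mul, ← h2 hs.1, h1 hlt, ENNReal.toReal_ofReal (hΦ _ hlt.le)]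

lemma convResolvent_lt_top (h : IsBorelVersion Φ φ) : ∀ᵐ t, convResolvent φ t < ∞ :=
  ae_lt_top (measurable_convResolvent h.measurable)
    (lintegral_convResolvent_lt_top h.measurable h.lintegral_lt_one).ne

lemma hawkesPsi_ae_eq (h : IsBorelVersion Φ φ) (hΦ : ∀ u, 0 ≤ u → 0 ≤ Φ u) :
    ∀ᵐ t, 0 < t → hawkesPsi Φ t = (convResolvent φ t).toReal := by
  filter_upwards [ae_all_iff.2 (h.iterConv_eq hΦ), h.convResolvent_lt_top] with t h1 h2 h0
  rw [convResolvent, ENNReal.tsum_toReal_eq]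
  · exact tsum_congr fun n => h1 n h0
  · exact fun n => ENNReal.ne_top_of_tsum_ne_top h2.ne n

end IsBorelVersion

/-! ### Predictability of integrals over the past, and measurability of jump integrals. -/

/-- The predictable σ-algebra on `Ω × ℝ`; times `s < 0` are given the σ-algebra `ℱ 0`. -/
@[reducible] def predictableSpace {Ω : Type*} {mΩ : MeasurableSpace Ω} (ℱ : Filtration ℝ≥0 mΩ) :
    MeasurableSpace (Ω × ℝ) :=
  MeasurableSpace.generateFrom
    {B | ∃ (s t : ℝ) (A : Set Ω), MeasurableSet[ℱ s.toNNReal] A ∧ B = A ×ˢ Ioc s t}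

section Predictable

variable {Ω : Type*} {mΩ : MeasurableSpace Ω} {ℱ : Filtration ℝ≥0 mΩ} {H : ℝ≥0 → Ω → ℕ}

lemma measurableSet_predictableSpace_prod_Ioc {s : ℝ} (t : ℝ) {A : Set Ω}
    (hA : MeasurableSet[ℱ s.toNNReal] A) : MeasurableSet[predictableSpace ℱ] (A ×ˢ Ioc s t) :=
  MeasurableSpace.measurableSet_generateFrom ⟨s, t, A, hA, rfl⟩

lemma predictableSpace_le : predictableSpace ℱ ≤ (inferInstance : MeasurableSpace (Ω × ℝ)) := by
  refine MeasurableSpace.generateFrom_le ?_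
  rintro _ ⟨s, t, A, hA, rfl⟩
  exact (ℱ.le _ _ hA).prod measurableSet_Ioc

lemma measurableSet_predictableSpace_prod_Ioi {s : ℝ} {A : Set Ω}
    (hA : MeasurableSet[ℱ s.toNNReal] A) : MeasurableSet[predictableSpace ℱ] (A ×ˢ Ioi s) := by
  have : A ×ˢ Ioi s = ⋃ n : ℕ, A ×ˢ Ioc s n := by
    ext ⟨ω, u⟩
    simp only [mem_prod, mem_Ioi, mem_iUnion, mem_Ioc]
    constructor
    · rintro ⟨h1, h2⟩
      obtain ⟨n, hn⟩ := exists_nat_ge u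
      exact ⟨n, h1, h2, hn⟩
    · rintro ⟨n, h1, h2, -⟩
      exact ⟨h1, h2⟩
  rw [this]
  exact MeasurableSet.iUnion fun n => measurableSet_predictableSpace_prod_Ioc _ hA

lemma measurable_snd_predictableSpace :
    Measurable[predictableSpace ℱ] (Prod.snd : Ω × ℝ → ℝ) := by
  let _ := predictableSpace ℱ
  refine measurable_of_Ioi fun s => ?_
  have : Prod.snd ⁻¹' Ioi s = (univ : Set Ω) ×ˢ Ioi s := by ext; simp
  rw [this]
  exact measurableSet_predictableSpace_prod_Ioi MeasurableSet.univ

/-- Passage times are stopping times: the event says that the path starts at most at `k` and exceeds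
`k` by time `t`. -/
lemma measurableSet_passageTime_le (hH : ∀ t, Measurable[ℱ t] (H t)) (hpath : ∀ ω, IsCountingPath fun t => H t ω)
    (k : ℕ) (t : ℝ) :
    MeasurableSet[ℱ t.toNNReal] {ω | PassesLevel (fun r => H r ω) k ∧
      (passageTime (fun r => H r ω) k : ℝ) ≤ t} := by
  have : {ω | PassesLevel (fun r => H r ω) k ∧ (passageTime (fun r => H r ω) k : ℝ) ≤ t}
      = {ω | H 0 ω ≤ k} ∩ {ω | k < H t.toNNReal ω} := by
    ext ω
    constructor
    · rintro ⟨h1, h2⟩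
      exact ⟨h1.1, ((hpath ω).coe_passageTime_le_iff h1 t).1 h2⟩
    · rintro ⟨h1, h2⟩
      have hp : PassesLevel (fun r => H r ω) k := ⟨h1, _, h2⟩
      exact ⟨hp, ((hpath ω).coe_passageTime_le_iff hp t).2 h2⟩
  rw [this]
  refine MeasurableSet.inter ?_ ?_
  · exact ℱ.mono zero_le _ (hH 0 measurableSet_Iic)
  · exact hH _ measurableSet_Ioi

/-- A rational between the passage time and the present decomposes the set into countably many
predictable rectangles. -/
lemma measurableSet_passageTime_lt (hH : ∀ t, Measurable[ℱ t] (H t))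
    (hpath : ∀ ω, IsCountingPath fun t => H t ω) (k : ℕ) :
    MeasurableSet[predictableSpace ℱ] {p : Ω × ℝ | PassesLevel (fun r => H r p.1) k ∧
      (passageTime (fun r => H r p.1) k : ℝ) < p.2} := by
  have : {p : Ω × ℝ | PassesLevel (fun r => H r p.1) k ∧
      (passageTime (fun r => H r p.1) k : ℝ) < p.2} = ⋃ q : ℚ,
      {ω | PassesLevel (fun r => H r ω) k ∧ (passageTime (fun r => H r ω) k : ℝ) ≤ (q : ℝ)} ×ˢ
        Ioi (q : ℝ) := by
    ext ⟨ω, u⟩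
    simp only [mem_iUnion, mem_prod, mem_Ioi]
    constructor
    · rintro ⟨h1, h2⟩
      obtain ⟨q, hq1, hq2⟩ := exists_rat_btwn h2
      exact ⟨q, ⟨h1, hq1.le⟩, hq2⟩
    · rintro ⟨q, ⟨h1, h2⟩, h3⟩
      exact ⟨h1, lt_of_le_of_lt h2 h3⟩
  rw [this]
  exact MeasurableSet.iUnion fun q =>
    measurableSet_predictableSpace_prod_Ioi (measurableSet_passageTime_le hH hpath k q)

open Classical in
/-- The time coordinate stopped at the passage time of level `k`. -/
noncomputable def stopAtPassage (H : ℝ≥0 → Ω → ℕ) (k : ℕ) (p : Ω × ℝ) : Ω × ℝ :=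
  (p.1, if PassesLevel (fun r => H r p.1) k ∧ (passageTime (fun r => H r p.1) k : ℝ) < p.2
    then (passageTime (fun r => H r p.1) k : ℝ) else p.2)

/-- Composing a predictable `F` with this map gives, once the passage has occurred, the value of `F`
at the passage time as a predictable function of the present. Sums over past jumps are built from
these compositions. -/
lemma measurable_stopAtPassage (hH : ∀ t, Measurable[ℱ t] (H t))
    (hpath : ∀ ω, IsCountingPath fun t => H t ω) (k : ℕ) :
    Measurable[predictableSpace ℱ, predictableSpace ℱ] (stopAtPassage H k) := by
  refine @measurable_generateFrom _ _ (predictableSpace ℱ) _ _ ?_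
  rintro _ ⟨s, t, A, hA, rfl⟩
  set D : ℝ → Set Ω := fun r => {ω | PassesLevel (fun r => H r ω) k ∧
      (passageTime (fun r => H r ω) k : ℝ) ≤ r} with hD
  -- The stopped time exceeds `s` when the present does and the passage is not before or at `s`. It
  -- is at most `t` when the present is, or when the passage has occurred by `t`.
  have hset : stopAtPassage H k ⁻¹' (A ×ˢ Ioc s t)
      = ((A ∩ (D s)ᶜ) ×ˢ Ioi s) ∩ (Prod.snd ⁻¹' Iic t ∪ D t ×ˢ Ioi t) := by
    ext ⟨ω, u⟩
    simp only [stopAtPassage, mem_preimage, mem_prod, mem_Ioc, mem_inter_iff, mem_union, mem_Ioi,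
      mem_Iic, mem_compl_iff]
    have hDiff : ∀ r, ω ∈ D r ↔ PassesLevel (fun r => H r ω) k ∧
      (passageTime (fun r => H r ω) k : ℝ) ≤ r := fun r => Iff.rfl
    rw [hDiff, hDiff]
    by_cases hp : PassesLevel (fun r => H r ω) k
    · simp only [hp, true_and]
      split_ifs with hlt
      · constructor
        · rintro ⟨h1, h2, h3⟩
          exact ⟨⟨⟨h1, not_le.2 h2⟩, h2.trans hlt⟩, (le_or_gt u t).imp_right fun h => ⟨h3, h⟩⟩
        · rintro ⟨⟨⟨h1, h2⟩, h3⟩, h4⟩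
          exact ⟨h1, not_le.1 h2, h4.elim (fun h => hlt.le.trans h) fun h => h.1⟩
      · constructor
        · rintro ⟨h1, h2, h3⟩
          exact ⟨⟨⟨h1, by linarith⟩, h2⟩, Or.inl h3⟩
        · rintro ⟨⟨⟨h1, h2⟩, h3⟩, h4⟩
          exact ⟨h1, h3, h4.elim id fun h => by linarith⟩
    · simp [hp, and_assoc]
  rw [hset]
  refine MeasurableSet.inter ?_ (MeasurableSet.union ?_ ?_)
  · exact measurableSet_predictableSpace_prod_Ioi
      (MeasurableSet.inter hA (measurableSet_passageTime_le hH hpath k s).compl)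
  · exact measurable_snd_predictableSpace measurableSet_Iic
  · exact measurableSet_predictableSpace_prod_Ioi (measurableSet_passageTime_le hH hpath k t)

/-- Sums over the past jumps, of predictable integrands depending also on the present time, are
predictable. -/
lemma measurable_lintegral_jumpMeasure_Iio (hH : ∀ t, Measurable[ℱ t] (H t))
    (hpath : ∀ ω, IsCountingPath fun t => H t ω) {F : Ω × ℝ → ℝ≥0∞}
    (hF : Measurable[predictableSpace ℱ] F) {φ : ℝ → ℝ≥0∞} (hφ : Measurable φ) :
    Measurable[predictableSpace ℱ] fun p : Ω × ℝ =>
      ∫⁻ v in Iio p.2, F (p.1, v) * φ (p.2 - v) ∂jumpMeasure fun r => H r p.1 := by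
  classical
  have heq : (fun p : Ω × ℝ => ∫⁻ v in Iio p.2, F (p.1, v) * φ (p.2 - v) ∂jumpMeasure fun r => H r p.1)
      = fun p => ∑' k, {p : Ω × ℝ | PassesLevel (fun r => H r p.1) k ∧
      (passageTime (fun r => H r p.1) k : ℝ) < p.2}.indicator
        (fun p => F (stopAtPassage H k p) * φ (p.2 - (stopAtPassage H k p).2)) p := by
    ext p
    rw [← lintegral_indicator measurableSet_Iio, lintegral_jumpMeasure]
    congr 1 with k
    by_cases h1 : PassesLevel (fun r => H r p.1) k
    · by_cases h2 : (passageTime (fun r => H r p.1) k : ℝ) < p.2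
      · rw [if_pos h1, indicator_of_mem (by exact h2), indicator_of_mem (by exact ⟨h1, h2⟩)]
        simp [stopAtPassage, h1, h2]
      · rw [if_pos h1, indicator_of_notMem (by exact h2), indicator_of_notMem (by exact fun h => h2 h.2)]
    · rw [if_neg h1, indicator_of_notMem (by exact fun h => h1 h.1)]
  rw [heq]
  let _ := predictableSpace ℱ
  have hsnd : Measurable (Prod.snd : Ω × ℝ → ℝ) := measurable_snd_predictableSpace
  refine Measurable.tsum fun k => ?_
  have hst := measurable_stopAtPassage hH hpath k
  refine Measurable.indicator ?_ (measurableSet_passageTime_lt hH hpath k)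
  exact (hF.comp hst).mul (hφ.comp (hsnd.sub (hsnd.comp hst)))

/-- Time integrals over the past of predictable integrands are predictable. -/
lemma measurable_lintegral_volume_Iio {G : Ω × ℝ → ℝ≥0∞} (hG : Measurable[predictableSpace ℱ] G)
    (μ : Measure ℝ) [SFinite μ] :
    Measurable[predictableSpace ℱ] fun p : Ω × ℝ => ∫⁻ v in Iio p.2, G (p.1, v) ∂μ := by
  let _ := predictableSpace ℱ
  have hsnd : Measurable (Prod.snd : Ω × ℝ → ℝ) := measurable_snd_predictableSpace
  -- On `v < u` the time `min v u` is just `v`. Capping at the present `u` makes the map measurable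
  -- for the predictable σ-algebra in `(ω, u)`, which `(ω, v)` alone would not be.
  have hmin : Measurable fun q : (Ω × ℝ) × ℝ => ((q.1.1, min q.2 q.1.2) : Ω × ℝ) := by
    refine measurable_generateFrom ?_
    rintro _ ⟨s, t, A, hA, rfl⟩
    have hset : (fun q : (Ω × ℝ) × ℝ => ((q.1.1, min q.2 q.1.2) : Ω × ℝ)) ⁻¹' (A ×ˢ Ioc s t)
        = ((A ×ˢ Ioi s) ×ˢ Ioi s) ∩ ({q | q.1.2 ≤ t} ∪ {q | q.2 ≤ t}) := by
      ext ⟨⟨ω, u⟩, v⟩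
      simp only [mem_preimage, mem_prod, mem_Ioc, mem_inter_iff, mem_union, mem_Ioi, lt_min_iff,
        min_le_iff, mem_ofPred_eq]
      tauto
    rw [hset]
    refine MeasurableSet.inter ?_ (MeasurableSet.union ?_ ?_)
    · exact (measurableSet_predictableSpace_prod_Ioi hA).prod measurableSet_Ioi
    · exact (hsnd.comp measurable_fst) measurableSet_Iic
    · exact measurable_snd measurableSet_Iic
  have heq : (fun p : Ω × ℝ => ∫⁻ v in Iio p.2, G (p.1, v) ∂μ)
      = fun p => ∫⁻ v, {q : (Ω × ℝ) × ℝ | q.2 < q.1.2}.indicator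
        (fun q => G (q.1.1, min q.2 q.1.2)) (p, v) ∂μ := by
    ext p
    rw [← lintegral_indicator measurableSet_Iio]
    refine lintegral_congr fun v => ?_
    by_cases hv : v < p.2
    · rw [indicator_of_mem (by exact hv), indicator_of_mem (by exact hv), min_eq_left hv.le]
    · rw [indicator_of_notMem (by exact hv), indicator_of_notMem (by exact hv)]
  rw [heq]
  refine Measurable.lintegral_prod_right' ?_
  exact Measurable.indicator (hG.comp hmin)
    (measurableSet_lt measurable_snd (hsnd.comp measurable_fst))

lemma measurable_passageTime (hH : ∀ t, Measurable (H t))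
    (hpath : ∀ ω, IsCountingPath fun t => H t ω) (k : ℕ) :
    Measurable fun ω => (passageTime (fun r => H r ω) k : ℝ) := by
  refine measurable_coe_nnreal_real.comp (measurable_of_Iic fun t => ?_)
  -- The infimum of the empty set is `0`, so paths that never exceed `k` have passage time `0` and
  -- must be added; integer times detect them by monotonicity.
  have : (fun ω => passageTime (fun r => H r ω) k) ⁻¹' Iic t
      = {ω | k < H t ω} ∪ ⋂ n : ℕ, {ω | H n ω ≤ k} := by
    ext ω
    simp only [mem_preimage, mem_Iic, mem_union, mem_iInter, mem_ofPred_eq]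
    by_cases hex : ∃ r, k < H r ω
    · rw [(hpath ω).passageTime_le_iff hex]
      refine ⟨Or.inl, fun h => h.elim id fun h => ?_⟩
      obtain ⟨r, hr⟩ := hex
      obtain ⟨n, hn⟩ := exists_nat_ge r
      have h1 : H r ω ≤ H n ω := (hpath ω).monotone hn
      have h2 := h n
      omega
    · push Not at hex
      have : {r : ℝ≥0 | k < H r ω} = ∅ := by
        ext r
        simpa using hex r
      rw [passageTime, this, NNReal.sInf_empty]
      exact iff_of_true zero_le (Or.inr fun n => hex n)
  rw [this]
  exact (hH t measurableSet_Ioi).union (MeasurableSet.iInter fun n => hH n measurableSet_Iic)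

lemma measurableSet_passesLevel (hH : ∀ t, Measurable (H t))
    (hpath : ∀ ω, IsCountingPath fun t => H t ω) (k : ℕ) :
    MeasurableSet {ω | PassesLevel (fun r => H r ω) k} := by
  have : {ω | PassesLevel (fun r => H r ω) k}
      = {ω | H 0 ω ≤ k} ∩ ⋃ n : ℕ, {ω | k < H n ω} := by
    ext ω
    simp only [mem_inter_iff, mem_iUnion, mem_ofPred_eq, PassesLevel]
    refine and_congr_right fun _ => ⟨?_, fun ⟨n, hn⟩ => ⟨n, hn⟩⟩
    rintro ⟨r, hr⟩
    obtain ⟨n, hn⟩ := exists_nat_ge r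
    exact ⟨n, hr.trans_le ((hpath ω).monotone hn)⟩
  rw [this]
  exact (hH 0 measurableSet_Iic).inter (MeasurableSet.iUnion fun n => hH n measurableSet_Ioi)

open Classical in
lemma measurable_lintegral_jumpMeasure (hH : ∀ t, Measurable (H t))
    (hpath : ∀ ω, IsCountingPath fun t => H t ω) {F : Ω × ℝ → ℝ≥0∞} (hF : Measurable F) :
    Measurable fun ω => ∫⁻ v, F (ω, v) ∂jumpMeasure fun r => H r ω := by
  simp_rw [lintegral_jumpMeasure]
  refine Measurable.tsum fun k => Measurable.ite (measurableSet_passesLevel hH hpath k) ?_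
    measurable_const
  exact hF.comp (measurable_id.prodMk (measurable_passageTime hH hpath k))

/-! ### The Campbell measure and the compensation formula. -/

/-- The Campbell measure of the jumps, on `Ω × ℝ`. -/
noncomputable def campbellMeasure (P : Measure Ω) (H : ℝ≥0 → Ω → ℕ) : Measure (Ω × ℝ) :=
  Measure.sum fun k => (P.restrict {ω | PassesLevel (fun r => H r ω) k}).map
    fun ω => (ω, (passageTime (fun r => H r ω) k : ℝ))

lemma lintegral_campbellMeasure (P : Measure Ω) (hH : ∀ t, Measurable (H t))
    (hpath : ∀ ω, IsCountingPath fun t => H t ω) {F : Ω × ℝ → ℝ≥0∞} (hF : Measurable F) :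
    ∫⁻ p, F p ∂campbellMeasure P H = ∫⁻ ω, ∫⁻ v, F (ω, v) ∂(jumpMeasure fun r => H r ω) ∂P := by
  classical
  have hm : ∀ k, Measurable fun ω => (ω, (passageTime (fun r => H r ω) k : ℝ)) := fun k =>
    measurable_id.prodMk (measurable_passageTime hH hpath k)
  simp_rw [lintegral_jumpMeasure]
  rw [campbellMeasure, lintegral_sum_measure, lintegral_tsum]
  · congr 1 with k
    rw [lintegral_map hF (hm k), ← lintegral_indicator (measurableSet_passesLevel hH hpath k)]
    rfl
  · exact fun k => (Measurable.ite (measurableSet_passesLevel hH hpath k) (hF.comp (hm k))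
      measurable_const).aemeasurable

/-- The time integral of `Λ` over `(0, ∞)`, as a measure. -/
noncomputable def intensityMeasure (Λ : Ω × ℝ → ℝ≥0∞) (ω : Ω) : Measure ℝ :=
  (volume.restrict (Ioi 0)).withDensity fun v => Λ (ω, v)

/-- The compensation formula for predictable integrands. -/
theorem lintegral_jumpMeasure_eq_intensityMeasure (P : Measure Ω) [IsProbabilityMeasure P]
    (hH : ∀ t, Measurable[ℱ t] (H t)) (hpath : ∀ ω, IsCountingPath fun t => H t ω)
    (hint : ∀ t, ∫⁻ ω, (H t ω : ℝ≥0∞) ∂P ≠ ∞) {Λ : Ω × ℝ → ℝ≥0∞} (hΛ : Measurable Λ)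
    (hcomp : ∀ s t : ℝ≥0, s ≤ t → ∀ A : Set Ω, MeasurableSet[ℱ s] A →
      ∫⁻ ω in A, ((H t ω - H s ω : ℕ) : ℝ≥0∞) ∂P
        = ∫⁻ ω in A, (∫⁻ r in Ioc (s : ℝ) t, Λ (ω, r)) ∂P)
    {F : Ω × ℝ → ℝ≥0∞} (hF : Measurable[predictableSpace ℱ] F) :
    ∫⁻ ω, ∫⁻ v, F (ω, v) ∂(jumpMeasure fun r => H r ω) ∂P
      = ∫⁻ ω, ∫⁻ v, F (ω, v) ∂intensityMeasure Λ ω ∂P := by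
  have hHm : ∀ t, Measurable (H t) := fun t => (hH t).mono (ℱ.le t) le_rfl
  set Q : Measure (Ω × ℝ) := (P.prod (volume.restrict (Ioi 0))).withDensity Λ with hQ
  have hFm : Measurable F := hF.mono predictableSpace_le le_rfl
  have hQint : ∫⁻ p, F p ∂Q = ∫⁻ ω, ∫⁻ v, F (ω, v) ∂intensityMeasure Λ ω ∂P := by
    rw [hQ, lintegral_withDensity_eq_lintegral_mul _ hΛ hFm, lintegral_prod _ (by fun_prop)]
    refine lintegral_congr fun ω => ?_
    rw [intensityMeasure, lintegral_withDensity_eq_lintegral_mul _ (by fun_prop) (by fun_prop)]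
    rfl
  rw [← hQint, ← lintegral_campbellMeasure P hHm hpath hFm, ← lintegral_trim predictableSpace_le hF,
    ← lintegral_trim predictableSpace_le hF]
  have hval : ∀ (s t : ℝ) (A : Set Ω), MeasurableSet[ℱ s.toNNReal] A →
      (campbellMeasure P H) (A ×ˢ Ioc s t)
        = ∫⁻ ω in A, ((H t.toNNReal ω - H s.toNNReal ω : ℕ) : ℝ≥0∞) ∂P := by
    intro s t A hA
    have hAm := ℱ.le _ _ hA
    rw [← lintegral_indicator_one (hAm.prod measurableSet_Ioc),
      lintegral_campbellMeasure P hHm hpath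
        (measurable_one.indicator (hAm.prod measurableSet_Ioc)), ← lintegral_indicator hAm]
    refine lintegral_congr fun ω => ?_
    by_cases hω : ω ∈ A
    · rw [indicator_of_mem hω, ← (hpath ω).jumpMeasure_Ioc, ← lintegral_indicator_one measurableSet_Ioc]
      refine lintegral_congr fun v => ?_
      by_cases hv : v ∈ Ioc s t
      · rw [indicator_of_mem hv, indicator_of_mem (mk_mem_prod hω hv)]
        rfl
      · rw [indicator_of_notMem hv, indicator_of_notMem fun h => hv h.2]
    · rw [indicator_of_notMem hω]
      simp [hω]
  have hval' : ∀ (s t : ℝ) (A : Set Ω), MeasurableSet[ℱ s.toNNReal] A → s ≤ t →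
      Q (A ×ˢ Ioc s t)
        = ∫⁻ ω in A, ((H t.toNNReal ω - H s.toNNReal ω : ℕ) : ℝ≥0∞) ∂P := by
    intro s t A hA hst
    have hAm := ℱ.le _ _ hA
    rw [hcomp _ _ (Real.toNNReal_mono hst) A hA, hQ,
      withDensity_apply _ (hAm.prod measurableSet_Ioc), ← Measure.prod_restrict,
      Measure.restrict_restrict measurableSet_Ioc, lintegral_prod _ (by fun_prop)]
    have : Ioc s t ∩ Ioi 0 = Ioc (s.toNNReal : ℝ) t.toNNReal := by
      ext u
      simp only [mem_inter_iff, mem_Ioc, mem_Ioi, Real.coe_toNNReal', max_lt_iff, le_max_iff]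
      constructor
      · rintro ⟨⟨h1, h2⟩, h3⟩
        exact ⟨⟨h1, h3⟩, Or.inl h2⟩
      · rintro ⟨⟨h1, h2⟩, h3⟩
        exact ⟨⟨h1, h3.elim id fun h => by linarith⟩, h2⟩
    rw [this]
  -- The generating rectangles form a π-system, the two measures agree on them by the definition of
  -- the intensity, and integrability of the process makes them finite on `Ω × (-n, n]`.
  have hmeas : (campbellMeasure P H).trim (predictableSpace_le (ℱ := ℱ))
      = Q.trim (predictableSpace_le (ℱ := ℱ)) := by
    refine @Measure.ext_of_generateFrom_of_iUnion _ (predictableSpace ℱ) _ _ _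
      (fun n : ℕ => (univ : Set Ω) ×ˢ Ioc (-n : ℝ) n) rfl ?_ ?_ ?_ ?_ ?_
    · rintro _ ⟨s, t, A, hA, rfl⟩ _ ⟨s', t', A', hA', rfl⟩ -
      refine ⟨max s s', min t t', A ∩ A', MeasurableSet.inter ?_ ?_, ?_⟩
      · exact ℱ.mono (Real.toNNReal_mono (le_max_left _ _)) _ hA
      · exact ℱ.mono (Real.toNNReal_mono (le_max_right _ _)) _ hA'
      · rw [prod_inter_prod, Ioc_inter_Ioc]
    · ext ⟨ω, u⟩
      obtain ⟨n, hn⟩ := exists_nat_gt |u|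
      simp only [mem_iUnion, mem_prod, mem_univ, true_and, mem_Ioc, iff_true]
      exact ⟨n, (abs_lt.1 hn).1, (abs_lt.1 hn).2.le⟩
    · exact fun n => ⟨-n, n, univ, MeasurableSet.univ, rfl⟩
    · intro n
      rw [trim_measurableSet_eq predictableSpace_le
        (measurableSet_predictableSpace_prod_Ioc _ MeasurableSet.univ),
        hval _ _ _ MeasurableSet.univ]
      refine ne_top_of_le_ne_top (hint (n : ℝ).toNNReal) ?_
      rw [Measure.restrict_univ]
      exact lintegral_mono fun ω => by simp
    · rintro _ ⟨s, t, A, hA, rfl⟩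
      have hm := measurableSet_predictableSpace_prod_Ioc (ℱ := ℱ) t hA
      rw [trim_measurableSet_eq predictableSpace_le hm, trim_measurableSet_eq predictableSpace_le hm]
      rcases le_total s t with hst | hst
      · rw [hval s t A hA, hval' s t A hA hst]
      · simp [Ioc_eq_empty (not_lt.2 hst)]
  rw [hmeas]

end Predictable

/-! ### Products of integrals and the second moment identity. -/

/-- The product of two integrals, split along the diagonal of the square. -/
lemma lintegral_mul_lintegral_eq_add (ν₁ ν₂ : Measure ℝ) [SFinite ν₁] [SFinite ν₂]
    {f g : ℝ → ℝ≥0∞} (hf : Measurable f) (hg : Measurable g) :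
    (∫⁻ v, f v ∂ν₁) * ∫⁻ u, g u ∂ν₂
      = ∫⁻ u, (∫⁻ v in Iio u, f v ∂ν₁) * g u ∂ν₂ + ∫⁻ v, f v * ∫⁻ u in Iic v, g u ∂ν₂ ∂ν₁ := by
  have hlt : MeasurableSet {p : ℝ × ℝ | p.2 < p.1} := measurableSet_lt measurable_snd measurable_fst
  have hle : MeasurableSet {p : ℝ × ℝ | p.1 ≤ p.2} := measurableSet_le measurable_fst measurable_snd
  have h1 : ∀ u, (∫⁻ v in Iio u, f v ∂ν₁) * g u
      = ∫⁻ v, {p : ℝ × ℝ | p.2 < p.1}.indicator (fun p => f p.2 * g p.1) (u, v) ∂ν₁ := by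
    intro u
    rw [← lintegral_mul_const _ hf, ← lintegral_indicator measurableSet_Iio]
    rfl
  have h2 : ∀ v, f v * ∫⁻ u in Iic v, g u ∂ν₂
      = ∫⁻ u, {p : ℝ × ℝ | p.1 ≤ p.2}.indicator (fun p => f p.2 * g p.1) (u, v) ∂ν₂ := by
    intro v
    rw [← lintegral_const_mul _ hg, ← lintegral_indicator measurableSet_Iic]
    rfl
  have hm1 : Measurable ({p : ℝ × ℝ | p.2 < p.1}.indicator fun p => f p.2 * g p.1) :=
    Measurable.indicator (by fun_prop) hlt
  have hm2 : Measurable ({p : ℝ × ℝ | p.1 ≤ p.2}.indicator fun p => f p.2 * g p.1) :=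
    Measurable.indicator (by fun_prop) hle
  simp_rw [h1, h2]
  rw [lintegral_lintegral_swap (μ := ν₁) (ν := ν₂)
    (by exact (hm2.comp measurable_swap).aemeasurable),
    ← lintegral_add_left hm1.lintegral_prod_right', ← lintegral_const_mul _ hg]
  refine lintegral_congr fun u => ?_
  have ha : Measurable fun v =>
      {p : ℝ × ℝ | p.2 < p.1}.indicator (fun p => f p.2 * g p.1) (u, v) :=
    hm1.comp measurable_prodMk_left
  rw [← lintegral_mul_const _ hf, ← lintegral_add_left ha]
  refine lintegral_congr fun v => ?_
  rcases lt_or_ge v u with h | h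
  · rw [indicator_of_mem (by exact h), indicator_of_notMem (by exact not_le.2 h), add_zero]
  · rw [indicator_of_notMem (by exact not_lt.2 h), indicator_of_mem (by exact h), zero_add]

/-- One half of the square contains the diagonal; separating it leaves two strictly ordered
integrals, plus `∫ f g` because atoms have mass one. -/
lemma IsCountingPath.lintegral_mul_lintegral_jumpMeasure {h : ℝ≥0 → ℕ} (hh : IsCountingPath h)
    {f g : ℝ → ℝ≥0∞} (hf : Measurable f) (hg : Measurable g) :
    (∫⁻ v, f v ∂jumpMeasure h) * ∫⁻ u, g u ∂jumpMeasure h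
      = ∫⁻ u, (∫⁻ v in Iio u, f v ∂jumpMeasure h) * g u ∂jumpMeasure h
        + ∫⁻ u, (∫⁻ v in Iio u, g v ∂jumpMeasure h) * f u ∂jumpMeasure h
        + ∫⁻ u, f u * g u ∂jumpMeasure h := by
  rw [lintegral_mul_lintegral_eq_add _ _ hf hg, add_assoc]
  congr 1
  have hm : Measurable fun u => ∫⁻ v in Iio u, g v ∂jumpMeasure h := by
    have : ∀ u, ∫⁻ v in Iio u, g v ∂jumpMeasure h
        = ∫⁻ v, {p : ℝ × ℝ | p.2 < p.1}.indicator (fun p => g p.2) (u, v) ∂jumpMeasure h := by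
      intro u
      rw [← lintegral_indicator measurableSet_Iio]
      rfl
    simp_rw [this]
    exact (Measurable.indicator (by fun_prop)
      (measurableSet_lt measurable_snd measurable_fst)).lintegral_prod_right'
  rw [← hh.lintegral_mul_jumpMeasure_singleton fun u => f u * g u,
    ← lintegral_add_left
      (show Measurable fun u => (∫⁻ v in Iio u, g v ∂jumpMeasure h) * f u from hm.mul hf)]
  refine lintegral_congr fun u => ?_
  rw [← Iio_union_right, lintegral_union (measurableSet_singleton u) (by simp),
    lintegral_singleton]
  ring

section Compensated

variable {Ω : Type*} {mΩ : MeasurableSpace Ω}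

/-- `Λ` is an intensity of the counting process `H`. -/
structure HasPredictableIntensity (P : Measure Ω) (ℱ : Filtration ℝ≥0 mΩ) (H : ℝ≥0 → Ω → ℕ)
    (Λ : Ω × ℝ → ℝ≥0∞) : Prop where
  adapted : ∀ t, Measurable[ℱ t] (H t)
  path : ∀ ω, IsCountingPath fun t => H t ω
  integrable : ∀ t, ∫⁻ ω, (H t ω : ℝ≥0∞) ∂P ≠ ∞
  predictable : Measurable[predictableSpace ℱ] Λ
  compensation : ∀ s t : ℝ≥0, s ≤ t → ∀ A : Set Ω, MeasurableSet[ℱ s] A →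
      ∫⁻ ω in A, ((H t ω - H s ω : ℕ) : ℝ≥0∞) ∂P
        = ∫⁻ ω in A, (∫⁻ r in Ioc (s : ℝ) t, Λ (ω, r)) ∂P

instance (Λ : Ω × ℝ → ℝ≥0∞) (ω : Ω) : SFinite (intensityMeasure Λ ω) := by
  unfold intensityMeasure; infer_instance

lemma lintegral_intensityMeasure {Λ : Ω × ℝ → ℝ≥0∞} (hΛ : Measurable Λ) (ω : Ω) {f : ℝ → ℝ≥0∞}
    (hf : Measurable f) :
    ∫⁻ v, f v ∂intensityMeasure Λ ω = ∫⁻ v in Ioi (0 : ℝ), Λ (ω, v) * f v := by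
  rw [intensityMeasure, lintegral_withDensity_eq_lintegral_mul _ (by fun_prop) hf]
  rfl

lemma setLIntegral_intensityMeasure_Iio {Λ : Ω × ℝ → ℝ≥0∞} (hΛ : Measurable Λ) (ω : Ω)
    {f : ℝ → ℝ≥0∞} (hf : Measurable f) (u : ℝ) :
    ∫⁻ v in Iio u, f v ∂intensityMeasure Λ ω
      = ∫⁻ v in Iio u, Λ (ω, v) * f v ∂volume.restrict (Ioi 0) := by
  rw [intensityMeasure, restrict_withDensity measurableSet_Iio,
    lintegral_withDensity_eq_lintegral_mul _ (by fun_prop) hf]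
  rfl

/-- There is no diagonal term because the compensator has no atoms. -/
lemma lintegral_mul_lintegral_intensityMeasure (ν : Measure ℝ) [SFinite ν] {Λ : Ω × ℝ → ℝ≥0∞}
    (ω : Ω) {f g : ℝ → ℝ≥0∞} (hf : Measurable f) (hg : Measurable g) :
    (∫⁻ v, f v ∂ν) * ∫⁻ u, g u ∂intensityMeasure Λ ω
      = ∫⁻ u, (∫⁻ v in Iio u, f v ∂ν) * g u ∂intensityMeasure Λ ω
        + ∫⁻ u, (∫⁻ v in Iio u, g v ∂intensityMeasure Λ ω) * f u ∂ν := by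
  have : NullSingletonClass (intensityMeasure Λ ω) := by unfold intensityMeasure; infer_instance
  rw [lintegral_mul_lintegral_eq_add _ _ hf hg]
  congr 1
  refine lintegral_congr fun u => ?_
  rw [mul_comm, Measure.restrict_congr_set Iio_ae_eq_Iic]

namespace HasPredictableIntensity

variable {P : Measure Ω} {ℱ : Filtration ℝ≥0 mΩ} {H : ℝ≥0 → Ω → ℕ}
  {Λ : Ω × ℝ → ℝ≥0∞}

lemma measurable (hΛ : HasPredictableIntensity P ℱ H Λ) : Measurable Λ :=
  hΛ.predictable.mono predictableSpace_le le_rfl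

lemma measurable_process (hΛ : HasPredictableIntensity P ℱ H Λ) (t : ℝ≥0) : Measurable (H t) :=
  (hΛ.adapted t).mono (ℱ.le t) le_rfl

lemma compensate [IsProbabilityMeasure P] (hΛ : HasPredictableIntensity P ℱ H Λ) {F : Ω × ℝ → ℝ≥0∞}
    (hF : Measurable[predictableSpace ℱ] F) :
    ∫⁻ ω, ∫⁻ v, F (ω, v) ∂(jumpMeasure fun r => H r ω) ∂P
      = ∫⁻ ω, ∫⁻ v, F (ω, v) ∂intensityMeasure Λ ω ∂P :=
  lintegral_jumpMeasure_eq_intensityMeasure P hΛ.adapted hΛ.path hΛ.integrable hΛ.measurable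
    hΛ.compensation hF

lemma measurable_jump (hΛ : HasPredictableIntensity P ℱ H Λ) {F : Ω × ℝ → ℝ≥0∞}
    (hF : Measurable F) : Measurable fun ω => ∫⁻ v, F (ω, v) ∂(jumpMeasure fun r => H r ω) :=
  measurable_lintegral_jumpMeasure hΛ.measurable_process hΛ.path hF

lemma measurable_intensity (hΛ : HasPredictableIntensity P ℱ H Λ) {F : Ω × ℝ → ℝ≥0∞}
    (hF : Measurable F) : Measurable fun ω => ∫⁻ v, F (ω, v) ∂intensityMeasure Λ ω := by
  have hm := hΛ.measurable
  have : ∀ ω, ∫⁻ v, F (ω, v) ∂intensityMeasure Λ ω = ∫⁻ v in Ioi (0 : ℝ), Λ (ω, v) * F (ω, v) :=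
    fun ω => lintegral_intensityMeasure hm ω (by fun_prop)
  simp_rw [this]
  exact (hm.mul hF).lintegral_prod_right'

/-- The second moment identity for integrals of predictable processes against the jumps and
against the compensator, in a form without subtractions. -/
theorem lintegral_mul_add_lintegral_mul [IsProbabilityMeasure P] (hΛ : HasPredictableIntensity P ℱ H Λ)
    {F G : Ω × ℝ → ℝ≥0∞} (hF : Measurable[predictableSpace ℱ] F)
    (hG : Measurable[predictableSpace ℱ] G) :
    ∫⁻ ω, (∫⁻ v, F (ω, v) ∂(jumpMeasure fun r => H r ω)) *
          ∫⁻ v, G (ω, v) ∂(jumpMeasure fun r => H r ω) ∂P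
      + ∫⁻ ω, (∫⁻ v, F (ω, v) ∂intensityMeasure Λ ω) * ∫⁻ v, G (ω, v) ∂intensityMeasure Λ ω ∂P
    = ∫⁻ ω, ∫⁻ v, F (ω, v) * G (ω, v) ∂(jumpMeasure fun r => H r ω) ∂P
      + ∫⁻ ω, (∫⁻ v, F (ω, v) ∂(jumpMeasure fun r => H r ω)) *
          ∫⁻ v, G (ω, v) ∂intensityMeasure Λ ω ∂P
      + ∫⁻ ω, (∫⁻ v, F (ω, v) ∂intensityMeasure Λ ω) *
          ∫⁻ v, G (ω, v) ∂(jumpMeasure fun r => H r ω) ∂P := by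
  have hm := hΛ.measurable
  have hFm : Measurable F := hF.mono predictableSpace_le le_rfl
  have hGm : Measurable G := hG.mono predictableSpace_le le_rfl
  have hJ : ∀ {F : Ω × ℝ → ℝ≥0∞}, Measurable[predictableSpace ℱ] F →
      Measurable[predictableSpace ℱ] fun p : Ω × ℝ =>
        ∫⁻ v in Iio p.2, F (p.1, v) ∂(jumpMeasure fun r => H r p.1) := by
    intro F hF
    simpa using measurable_lintegral_jumpMeasure_Iio hΛ.adapted hΛ.path hF (measurable_const (a := 1))
  have hI : ∀ {F : Ω × ℝ → ℝ≥0∞}, Measurable[predictableSpace ℱ] F →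
      Measurable[predictableSpace ℱ] fun p : Ω × ℝ =>
        ∫⁻ v in Iio p.2, F (p.1, v) ∂intensityMeasure Λ p.1 := by
    intro F hF
    have hFm : Measurable F := hF.mono predictableSpace_le le_rfl
    have : (fun p : Ω × ℝ => ∫⁻ v in Iio p.2, F (p.1, v) ∂intensityMeasure Λ p.1)
        = fun p => ∫⁻ v in Iio p.2, (fun q => Λ q * F q) (p.1, v) ∂volume.restrict (Ioi 0) := by
      ext p
      exact setLIntegral_intensityMeasure_Iio hm p.1 (by fun_prop) p.2
    rw [this]
    exact measurable_lintegral_volume_Iio (hΛ.predictable.mul hF) _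
  have hmix : ∀ {K L : Ω × ℝ → ℝ≥0∞}, Measurable[predictableSpace ℱ] K →
      Measurable[predictableSpace ℱ] L → Measurable[predictableSpace ℱ] fun p => K p * L p :=
    fun hK hL => hK.mul hL
  have hup : ∀ {K : Ω × ℝ → ℝ≥0∞}, Measurable[predictableSpace ℱ] K → Measurable K :=
    fun hK => hK.mono predictableSpace_le le_rfl
  have hFω : ∀ ω, Measurable fun v => F (ω, v) := fun ω => by fun_prop
  have hGω : ∀ ω, Measurable fun v => G (ω, v) := fun ω => by fun_prop
  -- The four products expand into eight ordered double integrals and one diagonal term. In each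
  -- ordered integral the inner one runs over the strict past, so the outer integrand is
  -- predictable.
  have e1 : ∀ ω, (∫⁻ v, F (ω, v) ∂(jumpMeasure fun r => H r ω)) *
          ∫⁻ v, G (ω, v) ∂(jumpMeasure fun r => H r ω) = _ :=
    fun ω => (hΛ.path ω).lintegral_mul_lintegral_jumpMeasure (hFω ω) (hGω ω)
  have e2 : ∀ ω, (∫⁻ v, F (ω, v) ∂intensityMeasure Λ ω) *
          ∫⁻ v, G (ω, v) ∂intensityMeasure Λ ω = _ :=
    fun ω => lintegral_mul_lintegral_intensityMeasure _ ω (hFω ω) (hGω ω)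
  have e3 : ∀ ω, (∫⁻ v, F (ω, v) ∂(jumpMeasure fun r => H r ω)) *
          ∫⁻ v, G (ω, v) ∂intensityMeasure Λ ω = _ :=
    fun ω => lintegral_mul_lintegral_intensityMeasure _ ω (hFω ω) (hGω ω)
  have e4 : ∀ ω, (∫⁻ v, F (ω, v) ∂intensityMeasure Λ ω) *
          ∫⁻ v, G (ω, v) ∂(jumpMeasure fun r => H r ω) = _ :=
    fun ω => (mul_comm _ _).trans
      (lintegral_mul_lintegral_intensityMeasure _ ω (hGω ω) (hFω ω))
  simp_rw [e1, e2, e3, e4]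
  have hJFG := hmix (hJ hF) hG
  have hJGF := hmix (hJ hG) hF
  have hIFG := hmix (hI hF) hG
  have hIGF := hmix (hI hG) hF
  have m1 : Measurable fun ω => ∫⁻ u, F (ω, u) * G (ω, u) ∂(jumpMeasure fun r => H r ω) :=
    hΛ.measurable_jump (hup (hmix hF hG))
  have m2 : Measurable fun ω => ∫⁻ u, (∫⁻ v in Iio u, F (ω, v) ∂(jumpMeasure fun r => H r ω)) *
      G (ω, u) ∂(jumpMeasure fun r => H r ω) := hΛ.measurable_jump (hup hJFG)
  have m3 : Measurable fun ω => ∫⁻ u, (∫⁻ v in Iio u, F (ω, v) ∂intensityMeasure Λ ω) *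
      G (ω, u) ∂intensityMeasure Λ ω := hΛ.measurable_intensity (hup hIFG)
  have m4 : Measurable fun ω => ∫⁻ u, (∫⁻ v in Iio u, F (ω, v) ∂(jumpMeasure fun r => H r ω)) *
      G (ω, u) ∂intensityMeasure Λ ω := hΛ.measurable_intensity (hup hJFG)
  have m5 : Measurable fun ω => ∫⁻ u, (∫⁻ v in Iio u, G (ω, v) ∂(jumpMeasure fun r => H r ω)) *
      F (ω, u) ∂intensityMeasure Λ ω := hΛ.measurable_intensity (hup hJGF)
  -- Compensation replaces every outer integral against the jumps by one against the compensator;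
  -- the ordered integrals on the two sides then match and only the diagonal term is left over.
  have c1 := hΛ.compensate hJFG
  have c2 := hΛ.compensate hJGF
  have c3 := hΛ.compensate hIFG
  have c4 := hΛ.compensate hIGF
  dsimp only at c1 c2 c3 c4
  rw [lintegral_add_right _ m1, lintegral_add_left m2, lintegral_add_left m3,
    lintegral_add_left m4, lintegral_add_left m5, c1, c2, c3, c4]
  ring

end HasPredictableIntensity

end Compensated

/-! ### Finiteness of second moments. -/

lemma IsCountingPath.jumpMeasure_Iic_le {h : ℝ≥0 → ℕ} (hh : IsCountingPath h) (T : ℝ) :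
    jumpMeasure h (Iic T) ≤ (h T.toNNReal : ℝ≥0∞) := by
  have : jumpMeasure h (Iic T) ≤ jumpMeasure h (Ioc 0 T) := by
    refine measure_mono_ae ?_
    filter_upwards [hh.ae_jumpMeasure_pos] with v hv hvT
    exact ⟨hv, hvT⟩
  refine this.trans ?_
  rw [hh.jumpMeasure_Ioc]
  exact_mod_cast Nat.sub_le _ _

/-- Elementary inequality: if `y ≤ b + q x` then `x - y` is comparable with `(1 - q) x`. -/
lemma ENNReal.half_sq_mul_add_le {q b x y : ℝ≥0∞} (hq : q < 1) (hb : b ≠ ∞) (hx : x ≠ ∞)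
    (hy : y ≤ b + q * x) :
    (1 - q) ^ 2 / 2 * (x * x) + 2 * (x * y) ≤ x * x + y * y + b * b := by
  have hq' : q ≠ ∞ := (hq.trans ENNReal.one_lt_top).ne
  have hy' : y ≠ ∞ := ne_top_of_le_ne_top (ENNReal.add_ne_top.2 ⟨hb, ENNReal.mul_ne_top hq' hx⟩) hy
  lift q to ℝ≥0 using hq'
  lift b to ℝ≥0 using hb
  lift x to ℝ≥0 using hx
  lift y to ℝ≥0 using hy'
  have hq1 : q < 1 := by exact_mod_cast hq
  have hy1 : (y : ℝ) ≤ b + q * x := by exact_mod_cast hy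
  have h2 : (2 : ℝ≥0∞) = ((2 : ℝ≥0) : ℝ≥0∞) := rfl
  rw [← ENNReal.coe_one, h2, ← ENNReal.coe_sub, ← ENNReal.coe_pow,
    ← ENNReal.coe_div two_ne_zero]
  norm_cast
  rw [← NNReal.coe_le_coe]
  push_cast [hq1.le]
  have hb0 := b.coe_nonneg
  have hx0 := x.coe_nonneg
  have hq2 : (q : ℝ) < 1 := by exact_mod_cast hq1
  -- With `z = (1 - q) x`, the claim is `z² / 2 ≤ (x - y)² + b²`. If `z ≤ b` it is clear. Otherwise
  -- `x - y ≥ z - b ≥ 0`, and `(z - b)² + b² - z² / 2 = (z - 2 b)² / 2`.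
  rcases le_total ((1 - q) * x : ℝ) b with h | h
  · nlinarith [mul_nonneg (sub_nonneg.2 hq2.le) hx0, sq_nonneg ((x : ℝ) - y),
      sq_nonneg ((1 - q) * x : ℝ)]
  · have h3 : 0 ≤ (1 - q) * (x : ℝ) - b := by linarith
    have h4 : (1 - q) * (x : ℝ) - b ≤ x - y := by linarith
    nlinarith [mul_self_le_mul_self h3 h4, sq_nonneg ((1 - q) * (x : ℝ) - 2 * b)]

section HawkesRate

variable {Ω : Type*} {mΩ : MeasurableSpace Ω}

/-- The intensity of a Hawkes process with baseline `c` and kernel `φ`. -/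
noncomputable def hawkesRate (c : ℝ≥0∞) (φ : ℝ → ℝ≥0∞) (H : ℝ≥0 → Ω → ℕ) (p : Ω × ℝ) : ℝ≥0∞ :=
  c + ∫⁻ v, φ (p.2 - v) ∂jumpMeasure fun r => H r p.1

lemma measurable_hawkesRate {ℱ : Filtration ℝ≥0 mΩ} {H : ℝ≥0 → Ω → ℕ}
    (hH : ∀ t, Measurable[ℱ t] (H t)) (hpath : ∀ ω, IsCountingPath fun t => H t ω) (c : ℝ≥0∞)
    {φ : ℝ → ℝ≥0∞} (hφ : Measurable φ) (h0 : ∀ t ≤ 0, φ t = 0) :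
    Measurable[predictableSpace ℱ] (hawkesRate c φ H) := by
  let _ := predictableSpace ℱ
  have heq : hawkesRate c φ H = fun p => c + ∫⁻ v in Iio p.2, 1 * φ (p.2 - v)
      ∂jumpMeasure fun r => H r p.1 := by
    ext p
    rw [hawkesRate, ← lintegral_indicator measurableSet_Iio]
    congr 1
    refine lintegral_congr fun v => ?_
    by_cases hv : v < p.2
    · rw [indicator_of_mem (by exact hv), one_mul]
    · rw [indicator_of_notMem (by exact hv), h0]
      linarith
  rw [heq]
  exact measurable_const.add
    (measurable_lintegral_jumpMeasure_Iio hH hpath (measurable_const (a := 1)) hφ)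

variable {P : Measure Ω} {ℱ : Filtration ℝ≥0 mΩ} {H : ℝ≥0 → Ω → ℕ} {c : ℝ≥0∞} {φ : ℝ → ℝ≥0∞}

namespace HasPredictableIntensity

/-- Integrals against the compensator of a Hawkes process are integrals against the jumps. -/
lemma lintegral_hawkesRate (hΛ : HasPredictableIntensity P ℱ H (hawkesRate c φ H))
    (hφ : Measurable φ) (h0 : ∀ t ≤ 0, φ t = 0) (ω : Ω) {f : ℝ → ℝ≥0∞} (hf : Measurable f) :
    ∫⁻ u, f u ∂intensityMeasure (hawkesRate c φ H) ω
      = c * (∫⁻ u in Ioi (0 : ℝ), f u)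
        + ∫⁻ v, (∫⁻ u, f u * φ (u - v)) ∂(jumpMeasure fun r => H r ω) := by
  rw [lintegral_intensityMeasure hΛ.measurable ω hf]
  simp only [hawkesRate, add_mul]
  rw [lintegral_add_left (by fun_prop), lintegral_const_mul _ hf]
  congr 1
  have h1 : ∀ u, (∫⁻ v, φ (u - v) ∂(jumpMeasure fun r => H r ω)) * f u
      = ∫⁻ v, f u * φ (u - v) ∂(jumpMeasure fun r => H r ω) := fun u => by
    rw [lintegral_const_mul _ (by fun_prop), mul_comm]
  simp_rw [h1]
  rw [lintegral_lintegral_swap (by fun_prop)]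
  refine lintegral_congr_ae ?_
  filter_upwards [(hΛ.path ω).ae_jumpMeasure_pos] with v hv
  rw [← lintegral_indicator measurableSet_Ioi]
  refine lintegral_congr fun u => ?_
  by_cases hu : u ∈ Ioi (0 : ℝ)
  · rw [indicator_of_mem hu]
  · rw [indicator_of_notMem hu, h0 (u - v), mul_zero]
    have : u ≤ 0 := not_lt.1 hu
    linarith

/-- Second moment bound for the jumps while their number is at most `n`. -/
lemma lintegral_sq_stopped_le [IsProbabilityMeasure P]
    (hΛ : HasPredictableIntensity P ℱ H (hawkesRate c φ H)) (hφ : Measurable φ)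
    (h0 : ∀ t ≤ 0, φ t = 0) (h1 : ∫⁻ t, φ t < 1) (hc : c ≠ ∞) (T : ℝ) (n : ℕ) {F : Ω × ℝ → ℝ≥0∞}
    (hFdef : F = {p : Ω × ℝ | p.2 ≤ T ∧ (jumpMeasure fun r => H r p.1) (Iio p.2) ≤ n}.indicator 1) :
    Measurable[predictableSpace ℱ] F ∧
    (1 - ∫⁻ t, φ t) ^ 2 / 2 * ∫⁻ ω, (∫⁻ v, F (ω, v) ∂(jumpMeasure fun r => H r ω)) *
      ∫⁻ v, F (ω, v) ∂(jumpMeasure fun r => H r ω) ∂P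
      ≤ ∫⁻ ω, (H T.toNNReal ω : ℝ≥0∞) ∂P + (c * ENNReal.ofReal T) * (c * ENNReal.ofReal T) := by
  set q := ∫⁻ t, φ t with hq
  set b := c * ENNReal.ofReal T with hb
  have hbtop : b ≠ ∞ := ENNReal.mul_ne_top hc ENNReal.ofReal_ne_top
  have hFpred : Measurable[predictableSpace ℱ] F := by
    let _ := predictableSpace ℱ
    have hsnd : Measurable (Prod.snd : Ω × ℝ → ℝ) := measurable_snd_predictableSpace
    have hcount : Measurable fun p : Ω × ℝ => (jumpMeasure fun r => H r p.1) (Iio p.2) := by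
      simpa using measurable_lintegral_jumpMeasure_Iio hΛ.adapted hΛ.path
        (measurable_const (a := (1 : ℝ≥0∞))) (measurable_const (a := 1))
    rw [hFdef]
    exact measurable_one.indicator ((hsnd measurableSet_Iic).inter (hcount measurableSet_Iic))
  refine ⟨hFpred, ?_⟩
  have hFm : Measurable F := hFpred.mono predictableSpace_le le_rfl
  have hFω : ∀ ω, Measurable fun v => F (ω, v) := fun ω => by fun_prop
  have hFle : ∀ p, F p ≤ 1 := fun p => by
    rw [hFdef]; exact indicator_le_self' (by simp) p
  have hFT : ∀ ω v, F (ω, v) ≤ (Iic T).indicator 1 v := by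
    intro ω v
    rw [hFdef]
    by_cases hv : v ≤ T
    · rw [indicator_of_mem (show v ∈ Iic T from hv)]
      exact indicator_le_self' (by simp) _
    · rw [indicator_of_notMem fun h => hv h.1]
      exact zero_le
  -- Once `F` has switched off it stays off; this monotonicity is what makes the compensator a
  -- contraction in `hyx`.
  have hFanti : ∀ ω u v, v ≤ u → F (ω, u) ≤ F (ω, v) := by
    intro ω u v hvu
    rw [hFdef]
    by_cases hu : (ω, u) ∈ {p : Ω × ℝ | p.2 ≤ T ∧ (jumpMeasure fun r => H r p.1) (Iio p.2) ≤ n}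
    · rw [indicator_of_mem hu, indicator_of_mem]
      · simp
      · exact ⟨hvu.trans hu.1, (measure_mono (Iio_subset_Iio hvu)).trans hu.2⟩
    · rw [indicator_of_notMem hu]
      exact zero_le
  have hFsq : ∀ p, F p * F p = F p := by
    intro p
    rw [hFdef, indicator_apply]
    split_ifs <;> simp
  set x : Ω → ℝ≥0∞ := fun ω => ∫⁻ v, F (ω, v) ∂(jumpMeasure fun r => H r ω) with hx
  set y : Ω → ℝ≥0∞ := fun ω => ∫⁻ v, F (ω, v) ∂intensityMeasure (hawkesRate c φ H) ω with hy
  have hxm : Measurable x := hΛ.measurable_jump hFm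
  have hym : Measurable y := hΛ.measurable_intensity hFm
  have hxH : ∀ ω, x ω ≤ H T.toNNReal ω := by
    intro ω
    refine (lintegral_mono (hFT ω)).trans ?_
    rw [lintegral_indicator_one measurableSet_Iic]
    exact (hΛ.path ω).jumpMeasure_Iic_le T
  have hxtop : ∀ ω, x ω ≠ ∞ := fun ω => ne_top_of_le_ne_top (by simp) (hxH ω)
  -- Each jump counted by `F` is preceded by at most `n` jumps. This bound depends on `n` and serves
  -- only to make `E[x²]` and `E[x y]` finite, so that `2 E[x y]` can be cancelled.
  have hxx : ∀ ω, x ω * x ω ≤ (2 * n + 1) * x ω := by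
    intro ω
    have hn : ∀ u, (∫⁻ v in Iio u, F (ω, v) ∂(jumpMeasure fun r => H r ω)) * F (ω, u)
        ≤ n * F (ω, u) := by
      intro u
      by_cases hu : (ω, u) ∈ {p : Ω × ℝ | p.2 ≤ T ∧ (jumpMeasure fun r => H r p.1) (Iio p.2) ≤ n}
      · gcongr
        refine (lintegral_mono fun v => hFle _).trans ?_
        simpa using hu.2
      · rw [hFdef, indicator_of_notMem hu]
        simp
    simp only [hx]
    rw [(hΛ.path ω).lintegral_mul_lintegral_jumpMeasure (hFω ω) (hFω ω)]
    simp_rw [hFsq]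
    have := lintegral_mono (μ := jumpMeasure fun r => H r ω) hn
    rw [lintegral_const_mul _ (hFω ω)] at this
    calc _ ≤ (n : ℝ≥0∞) * ∫⁻ v, F (ω, v) ∂(jumpMeasure fun r => H r ω)
          + n * ∫⁻ v, F (ω, v) ∂(jumpMeasure fun r => H r ω)
          + ∫⁻ v, F (ω, v) ∂(jumpMeasure fun r => H r ω) :=
          add_le_add (add_le_add this this) le_rfl
      _ = _ := by ring
  -- The baseline contributes at most `c T`. Each jump at `v` contributes `∫ F u φ (u - v) du ≤ q F
  -- v`, as `F` is nonincreasing in time and `φ` lives on positive arguments.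
  have hyx : ∀ ω, y ω ≤ b + q * x ω := by
    intro ω
    simp only [hy]
    rw [hΛ.lintegral_hawkesRate hφ h0 ω (hFω ω)]
    refine add_le_add ?_ ?_
    · rw [hb]
      gcongr
      refine (lintegral_mono (hFT ω)).trans ?_
      rw [lintegral_indicator_one measurableSet_Iic, Measure.restrict_apply measurableSet_Iic,
        inter_comm, Ioi_inter_Iic, Real.volume_Ioc, sub_zero]
    · rw [hx, ← lintegral_const_mul _ (hFω ω)]
      refine lintegral_mono fun v => ?_
      calc ∫⁻ u, F (ω, u) * φ (u - v) ≤ ∫⁻ u, F (ω, v) * φ (u - v) := by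
            refine lintegral_mono fun u => ?_
            rcases le_total v u with h | h
            · gcongr
              exact hFanti ω u v h
            · simp [h0 (u - v) (by linarith)]
        _ = q * F (ω, v) := by
            rw [lintegral_const_mul _ (by fun_prop), lintegral_sub_right_eq_self, mul_comm]
  have hEx : ∫⁻ ω, x ω ∂P ≤ ∫⁻ ω, (H T.toNNReal ω : ℝ≥0∞) ∂P := lintegral_mono hxH
  have hExtop : ∫⁻ ω, x ω ∂P ≠ ∞ := ne_top_of_le_ne_top (hΛ.integrable _) hEx
  have hExxtop : ∫⁻ ω, x ω * x ω ∂P ≠ ∞ := by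
    refine ne_top_of_le_ne_top ?_ (lintegral_mono hxx)
    rw [lintegral_const_mul _ hxm]
    exact ENNReal.mul_ne_top (by finiteness) hExtop
  have hExytop : ∫⁻ ω, x ω * y ω ∂P ≠ ∞ := by
    have hle : ∀ ω, x ω * y ω ≤ b * x ω + q * (x ω * x ω) := fun ω =>
      (mul_le_mul_right (hyx ω) _).trans_eq (by ring)
    refine ne_top_of_le_ne_top ?_ (lintegral_mono hle)
    rw [lintegral_add_left (by fun_prop), lintegral_const_mul _ hxm,
      lintegral_const_mul _ (by fun_prop)]
    exact ENNReal.add_ne_top.2 ⟨ENNReal.mul_ne_top hbtop hExtop,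
      ENNReal.mul_ne_top (h1.trans ENNReal.one_lt_top).ne hExxtop⟩
  -- As `F² = F`, the identity reads `E[(x - y)²] = E[x]`. Together with the elementary inequality
  -- it bounds `E[x²]` independently of `n`.
  have hstar := hΛ.lintegral_mul_add_lintegral_mul hFpred hFpred
  simp_rw [hFsq] at hstar
  have hstar' : ∫⁻ ω, x ω * x ω ∂P + ∫⁻ ω, y ω * y ω ∂P
      = ∫⁻ ω, x ω ∂P + ∫⁻ ω, x ω * y ω ∂P + ∫⁻ ω, x ω * y ω ∂P := by
    rw [show ∫⁻ ω, x ω * y ω ∂P = ∫⁻ ω, y ω * x ω ∂P from by simp_rw [mul_comm]]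
    nth_rewrite 1 [show ∫⁻ ω, y ω * x ω ∂P = ∫⁻ ω, x ω * y ω ∂P from by simp_rw [mul_comm]]
    exact hstar
  have hpt := lintegral_mono (μ := P) fun ω =>
    ENNReal.half_sq_mul_add_le h1 hbtop (hxtop ω) (hyx ω)
  rw [lintegral_add_left (by fun_prop), lintegral_const_mul _ (by fun_prop),
    lintegral_const_mul _ (by fun_prop), lintegral_add_right _ (by fun_prop),
    lintegral_add_left (by fun_prop), hstar', lintegral_const, measure_univ, mul_one] at hpt
  have hfin : 2 * ∫⁻ ω, x ω * y ω ∂P ≠ ∞ := ENNReal.mul_ne_top (by simp) hExytop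
  refine (ENNReal.add_le_add_iff_right hfin).1 (hpt.trans ?_)
  calc _ = (∫⁻ ω, x ω ∂P + b * b) + 2 * ∫⁻ ω, x ω * y ω ∂P := by ring
    _ ≤ _ := by gcongr

/-- A Hawkes process with integrable kernel of mass less than one has finite second moments. -/
theorem lintegral_sq_jumpMeasure_Iic_ne_top [IsProbabilityMeasure P]
    (hΛ : HasPredictableIntensity P ℱ H (hawkesRate c φ H)) (hφ : Measurable φ)
    (h0 : ∀ t ≤ 0, φ t = 0) (h1 : ∫⁻ t, φ t < 1) (hc : c ≠ ∞) (T : ℝ) :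
    ∫⁻ ω, (jumpMeasure fun r => H r ω) (Iic T) * (jumpMeasure fun r => H r ω) (Iic T) ∂P ≠ ∞ := by
  set F : ℕ → Ω × ℝ → ℝ≥0∞ := fun n =>
    {p : Ω × ℝ | p.2 ≤ T ∧ (jumpMeasure fun r => H r p.1) (Iio p.2) ≤ n}.indicator 1 with hF
  set x : ℕ → Ω → ℝ≥0∞ := fun n ω => ∫⁻ v, F n (ω, v) ∂(jumpMeasure fun r => H r ω) with hx
  have hb := fun n => hΛ.lintegral_sq_stopped_le hφ h0 h1 hc T n (F := F n) rfl
  have hFm : ∀ n, Measurable (F n) := fun n => (hb n).1.mono predictableSpace_le le_rfl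
  have hFmono : ∀ ω v, Monotone fun n => F n (ω, v) := by
    intro ω v n m hnm
    refine indicator_le_indicator_of_subset ?_ (fun _ => zero_le) _
    exact fun p hp => ⟨hp.1, hp.2.trans (by exact_mod_cast hnm)⟩
  have hxmono : ∀ ω, Monotone fun n => x n ω := fun ω n m hnm =>
    lintegral_mono fun v => hFmono ω v hnm
  have hsup : ∀ ω, ⨆ n, x n ω = (jumpMeasure fun r => H r ω) (Iic T) := by
    intro ω
    rw [← lintegral_indicator_one measurableSet_Iic, ← lintegral_iSup]
    · refine lintegral_congr fun v => ?_
      by_cases hv : v ≤ T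
      · rw [indicator_of_mem (show v ∈ Iic T from hv)]
        have hfin : (jumpMeasure fun r => H r ω) (Iio v) ≤ H v.toNNReal ω :=
          (measure_mono Iio_subset_Iic_self).trans ((hΛ.path ω).jumpMeasure_Iic_le v)
        refine le_antisymm (iSup_le fun n => indicator_le_self' (by simp) _) ?_
        -- The number of jumps before `v` is at most the value of the process at `v`, so the
        -- restriction is inactive from that index on.
        refine le_iSup_of_le (H v.toNNReal ω) ?_
        simp only [hF]
        rw [indicator_of_mem (show (ω, v) ∈ {p : Ω × ℝ | p.2 ≤ T ∧
          (jumpMeasure fun r => H r p.1) (Iio p.2) ≤ (H v.toNNReal ω : ℝ≥0∞)} from ⟨hv, hfin⟩)]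
        rfl
      · rw [indicator_of_notMem (show v ∉ Iic T from hv)]
        simp only [hF]
        simp [hv]
    · exact fun n => (hFm n).comp measurable_prodMk_left
    · exact fun n m hnm v => hFmono ω v hnm
  have hlim : Filter.Tendsto (fun n => ∫⁻ ω, x n ω * x n ω ∂P) Filter.atTop
      (nhds (∫⁻ ω, (jumpMeasure fun r => H r ω) (Iic T) *
        (jumpMeasure fun r => H r ω) (Iic T) ∂P)) := by
    refine lintegral_tendsto_of_tendsto_of_monotone
      (fun n => ((hΛ.measurable_jump (hFm n)).mul (hΛ.measurable_jump (hFm n))).aemeasurable) ?_ ?_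
    · exact ae_of_all _ fun ω n m hnm => mul_le_mul' (hxmono ω hnm) (hxmono ω hnm)
    · refine ae_of_all _ fun ω => ?_
      have ht : Filter.Tendsto (fun n => x n ω) Filter.atTop
          (nhds ((jumpMeasure fun r => H r ω) (Iic T))) := by
        rw [← hsup ω]
        exact tendsto_atTop_iSup (hxmono ω)
      have hfin : (jumpMeasure fun r => H r ω) (Iic T) ≠ ∞ :=
        ne_top_of_le_ne_top (by simp) ((hΛ.path ω).jumpMeasure_Iic_le T)
      exact ENNReal.Tendsto.mul ht (Or.inr hfin) ht (Or.inr hfin)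
  set α := (1 - ∫⁻ t, φ t) ^ 2 / 2 with hα
  have hα0 : α ≠ 0 := by
    rw [hα]
    refine (ENNReal.div_pos (pow_ne_zero 2 (tsub_pos_of_lt h1).ne') (by simp)).ne'
  have hαt : α ≠ ∞ := by
    rw [hα]
    refine ENNReal.div_ne_top (ENNReal.pow_ne_top (ne_top_of_le_ne_top ENNReal.one_ne_top
      tsub_le_self)) (by simp)
  -- The bound is uniform in `n` and passes to the monotone limit; since `α > 0`, an infinite limit
  -- would contradict it.
  have hle := le_of_tendsto' (ENNReal.Tendsto.const_mul hlim (Or.inr hαt)) fun n => (hb n).2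
  intro htop
  rw [htop, ENNReal.mul_top hα0, top_le_iff] at hle
  exact ENNReal.add_ne_top.2 ⟨hΛ.integrable _, ENNReal.mul_ne_top
    (ENNReal.mul_ne_top hc ENNReal.ofReal_ne_top) (ENNReal.mul_ne_top hc ENNReal.ofReal_ne_top)⟩ hle

end HasPredictableIntensity

end HawkesRate

/-! ### Moments of linear functionals with bounded weights. -/

/-- The expansion of the product of `x = a - b + κ` and `x' = a' - b' + κ'`. -/
lemma ENNReal.mul_add_eq_of_add_eq {a b κ x a' b' κ' x' : ℝ≥0∞} (ha : a ≠ ∞) (hb : b ≠ ∞)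
    (hκ : κ ≠ ∞) (ha' : a' ≠ ∞) (hb' : b' ≠ ∞) (hκ' : κ' ≠ ∞) (h : a + κ = x + b)
    (h' : a' + κ' = x' + b') :
    x * x' + (a * b' + b * a' + κ * b' + κ' * b)
      = a * a' + b * b' + κ * a' + κ' * a + κ * κ' := by
  have hx : x ≠ ∞ := fun hx => by simp [hx, ha, hκ] at h
  have hx' : x' ≠ ∞ := fun hx => by simp [hx, ha', hκ'] at h'
  lift a to ℝ≥0 using ha
  lift b to ℝ≥0 using hb
  lift κ to ℝ≥0 using hκ
  lift x to ℝ≥0 using hx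
  lift a' to ℝ≥0 using ha'
  lift b' to ℝ≥0 using hb'
  lift κ' to ℝ≥0 using hκ'
  lift x' to ℝ≥0 using hx'
  norm_cast at h h' ⊢
  rw [← NNReal.coe_inj] at h h' ⊢
  push_cast at h h' ⊢
  have e : (x : ℝ) = a + κ - b := by linarith
  have e' : (x' : ℝ) = a' + κ' - b' := by linarith
  rw [e, e']
  ring

lemma lintegral_le_mul_measure_Iic (ν : Measure ℝ) {f : ℝ → ℝ≥0∞} {C : ℝ≥0∞} {T : ℝ}
    (hfC : ∀ v, f v ≤ C) (hfT : ∀ v, T < v → f v = 0) : ∫⁻ v, f v ∂ν ≤ C * ν (Iic T) := by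
  have : ∀ v, f v ≤ (Iic T).indicator (fun _ => C) v := by
    intro v
    by_cases hv : v ≤ T
    · rw [indicator_of_mem (by exact hv)]; exact hfC v
    · rw [hfT v (not_le.1 hv)]; exact zero_le
  refine (lintegral_mono this).trans_eq ?_
  rw [lintegral_indicator measurableSet_Iic, setLIntegral_const]

lemma setLIntegral_Ioi_lt_top {f : ℝ → ℝ≥0∞} {C : ℝ≥0∞} {T : ℝ} (hC : C ≠ ∞) (hfC : ∀ v, f v ≤ C)
    (hfT : ∀ v, T < v → f v = 0) : ∫⁻ v in Ioi (0 : ℝ), f v < ∞ := by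
  refine (lintegral_le_mul_measure_Iic _ hfC hfT).trans_lt ?_
  rw [Measure.restrict_apply measurableSet_Iic, inter_comm, Ioi_inter_Iic, Real.volume_Ioc]
  exact ENNReal.mul_lt_top hC.lt_top ENNReal.ofReal_lt_top

section HawkesMoments

variable {Ω : Type*} {mΩ : MeasurableSpace Ω} {P : Measure Ω} {ℱ : Filtration ℝ≥0 mΩ}
  {H : ℝ≥0 → Ω → ℕ} {c : ℝ≥0∞} {φ : ℝ → ℝ≥0∞}

lemma measurable_comp_snd_predictableSpace {f : ℝ → ℝ≥0∞} (hf : Measurable f) :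
    Measurable[predictableSpace ℱ] fun p : Ω × ℝ => f p.2 :=
  hf.comp measurable_snd_predictableSpace

namespace HasPredictableIntensity

/-- With `f` the transform of `g`, this is `N(g) = c ∫ f + (N - A)(f)` without subtractions. The
compensator of `f` is `c ∫ f` plus the jump integral of `∫ f u φ (u - ·) du`, which by the renewal
equation is `f - g`. -/
lemma lintegral_renewalTransform_add (hΛ : HasPredictableIntensity P ℱ H (hawkesRate c φ H))
    (hφ : Measurable φ) (h0 : ∀ t ≤ 0, φ t = 0) {g : ℝ → ℝ≥0∞} (hg : Measurable g) (ω : Ω) :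
    ∫⁻ v, renewalTransform φ g v ∂(jumpMeasure fun r => H r ω)
        + c * ∫⁻ v in Ioi (0 : ℝ), renewalTransform φ g v
      = ∫⁻ v, g v ∂(jumpMeasure fun r => H r ω)
        + ∫⁻ v, renewalTransform φ g v ∂intensityMeasure (hawkesRate c φ H) ω := by
  rw [hΛ.lintegral_hawkesRate hφ h0 ω (measurable_renewalTransform hφ hg),
    lintegral_congr (renewalTransform_eq hφ hg), lintegral_add_left hg]
  ring

section Bounded

variable [IsProbabilityMeasure P]

/-- Take expectations in the previous identity: `f` has equal means against the jumps and the
compensator, and boundedness makes that common mean finite, so it cancels. -/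
lemma lintegral_jumpMeasure_of_le (hΛ : HasPredictableIntensity P ℱ H (hawkesRate c φ H))
    (hφ : Measurable φ) (h0 : ∀ t ≤ 0, φ t = 0) (h1 : ∫⁻ t, φ t < 1) {g : ℝ → ℝ≥0∞}
    (hg : Measurable g) {C : ℝ≥0∞} {T : ℝ} (hC : C ≠ ∞) (hgC : ∀ v, g v ≤ C)
    (hgT : ∀ v, T < v → g v = 0) :
    ∫⁻ ω, ∫⁻ v, g v ∂(jumpMeasure fun r => H r ω) ∂P
      = c * ∫⁻ v in Ioi (0 : ℝ), renewalTransform φ g v := by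
  set f := renewalTransform φ g with hf
  have hfm : Measurable f := measurable_renewalTransform hφ hg
  have hfC : ∀ v, f v ≤ C * (1 + ∫⁻ t, convResolvent φ t) := renewalTransform_le hφ hgC
  have hCtop : C * (1 + ∫⁻ t, convResolvent φ t) ≠ ∞ := ENNReal.mul_ne_top hC
    (ENNReal.add_ne_top.2 ⟨ENNReal.one_ne_top, (lintegral_convResolvent_lt_top hφ h1).ne⟩)
  have hfT : ∀ v, T < v → f v = 0 := fun v => renewalTransform_of_lt h0 hgT
  have hcomp := hΛ.compensate (measurable_comp_snd_predictableSpace (ℱ := ℱ) hfm)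
  have hfin : ∫⁻ ω, ∫⁻ v, f v ∂(jumpMeasure fun r => H r ω) ∂P ≠ ∞ := by
    refine ne_top_of_le_ne_top ?_ (lintegral_mono fun ω =>
      (lintegral_le_mul_measure_Iic _ hfC hfT).trans
        (mul_le_mul_right ((hΛ.path ω).jumpMeasure_Iic_le T) _))
    rw [lintegral_const_mul' _ _ hCtop]
    exact ENNReal.mul_ne_top hCtop (hΛ.integrable _)
  have hgm : Measurable fun ω => ∫⁻ v, g v ∂(jumpMeasure fun r => H r ω) :=
    hΛ.measurable_jump (F := fun p => g p.2) (by fun_prop)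
  have hsum := lintegral_congr (μ := P) (hΛ.lintegral_renewalTransform_add hφ h0 hg)
  rw [lintegral_add_right _ measurable_const, lintegral_const, measure_univ, mul_one,
    lintegral_add_left hgm, ← hf, ← hcomp, add_comm] at hsum
  exact ((ENNReal.add_left_inj hfin).1 hsum).symm

/-- The centred functionals are compensated integrals of the transforms `f` and `l`. By the second
moment identity their covariance is the mean jump integral of `f * l`, which the first moment
formula evaluates. -/
lemma lintegral_jump_mul_jump_of_le (hΛ : HasPredictableIntensity P ℱ H (hawkesRate c φ H))
    (hφ : Measurable φ) (h0 : ∀ t ≤ 0, φ t = 0) (h1 : ∫⁻ t, φ t < 1) (hc : c ≠ ∞)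
    {g k : ℝ → ℝ≥0∞} (hg : Measurable g) (hk : Measurable k) {C : ℝ≥0∞} {T : ℝ} (hC : C ≠ ∞)
    (hgC : ∀ v, g v ≤ C) (hkC : ∀ v, k v ≤ C) (hgT : ∀ v, T < v → g v = 0)
    (hkT : ∀ v, T < v → k v = 0) :
    ∫⁻ ω, (∫⁻ v, g v ∂(jumpMeasure fun r => H r ω)) * ∫⁻ v, k v ∂(jumpMeasure fun r => H r ω) ∂P
      = (c * ∫⁻ v in Ioi (0 : ℝ), renewalTransform φ g v) *
          (c * ∫⁻ v in Ioi (0 : ℝ), renewalTransform φ k v)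
        + c * ∫⁻ v in Ioi (0 : ℝ),
            renewalTransform φ g v * renewalTransform φ k v * renewalDensity φ v := by
  set D := C * (1 + ∫⁻ t, convResolvent φ t) with hD
  have hDtop : D ≠ ∞ := ENNReal.mul_ne_top hC
    (ENNReal.add_ne_top.2 ⟨ENNReal.one_ne_top, (lintegral_convResolvent_lt_top hφ h1).ne⟩)
  have hfm : Measurable (renewalTransform φ g) := measurable_renewalTransform hφ hg
  have hlm : Measurable (renewalTransform φ k) := measurable_renewalTransform hφ hk
  have hfD : ∀ v, renewalTransform φ g v ≤ D := renewalTransform_le hφ hgC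
  have hlD : ∀ v, renewalTransform φ k v ≤ D := renewalTransform_le hφ hkC
  have hfT : ∀ v, T < v → renewalTransform φ g v = 0 := fun v => renewalTransform_of_lt h0 hgT
  have hlT : ∀ v, T < v → renewalTransform φ k v = 0 := fun v => renewalTransform_of_lt h0 hkT
  have haddg := hΛ.lintegral_renewalTransform_add hφ h0 hg
  have haddk := hΛ.lintegral_renewalTransform_add hφ h0 hk
  set f := renewalTransform φ g
  set l := renewalTransform φ k
  set κ := c * ∫⁻ v in Ioi (0 : ℝ), f v with hκ
  set κ' := c * ∫⁻ v in Ioi (0 : ℝ), l v with hκ'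
  have hκtop : κ ≠ ∞ := ENNReal.mul_ne_top hc (setLIntegral_Ioi_lt_top hDtop hfD hfT).ne
  have hκtop' : κ' ≠ ∞ := ENNReal.mul_ne_top hc (setLIntegral_Ioi_lt_top hDtop hlD hlT).ne
  set Y : Ω → ℝ≥0∞ := fun ω => (jumpMeasure fun r => H r ω) (Iic T) with hY
  have hYm : Measurable Y := by
    have := hΛ.measurable_jump (F := fun p => (Iic T).indicator 1 p.2)
      ((measurable_one.indicator measurableSet_Iic).comp measurable_snd)
    simpa [lintegral_indicator_one measurableSet_Iic] using this
  have hYtop : ∀ ω, Y ω ≠ ∞ := fun ω =>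
    ne_top_of_le_ne_top (by simp) ((hΛ.path ω).jumpMeasure_Iic_le T)
  have hEY : ∫⁻ ω, Y ω ∂P ≠ ∞ := ne_top_of_le_ne_top (hΛ.integrable T.toNNReal)
    (lintegral_mono fun ω => (hΛ.path ω).jumpMeasure_Iic_le T)
  have hEYY : ∫⁻ ω, Y ω * Y ω ∂P ≠ ∞ := hΛ.lintegral_sq_jumpMeasure_Iic_ne_top hφ h0 h1 hc T
  -- all four integrals are bounded by a square integrable variable
  set Z : Ω → ℝ≥0∞ := fun ω => D * Y ω + (κ + κ') with hZ
  have hZm : Measurable Z := by fun_prop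
  have hZtop : ∀ ω, Z ω ≠ ∞ := fun ω => ENNReal.add_ne_top.2
    ⟨ENNReal.mul_ne_top hDtop (hYtop ω), ENNReal.add_ne_top.2 ⟨hκtop, hκtop'⟩⟩
  have hEZZ : ∫⁻ ω, Z ω * Z ω ∂P ≠ ∞ := by
    have : ∀ ω, Z ω * Z ω = D * D * (Y ω * Y ω) + (2 * D * (κ + κ')) * Y ω
        + (κ + κ') * (κ + κ') := fun ω => by simp only [hZ]; ring
    simp_rw [this]
    rw [lintegral_add_left (by fun_prop), lintegral_add_left (by fun_prop),
      lintegral_const_mul _ (by fun_prop), lintegral_const_mul _ (by fun_prop), lintegral_const,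
      measure_univ]
    finiteness
  have hZ1 : ∀ ω, Z ω ≤ 1 + Z ω * Z ω := by
    intro ω
    rcases le_total (Z ω) 1 with h | h
    · exact h.trans le_self_add
    · exact (le_mul_of_one_le_left zero_le h).trans le_add_self
  have hEZ : ∫⁻ ω, Z ω ∂P ≠ ∞ := by
    refine ne_top_of_le_ne_top ?_ (lintegral_mono hZ1)
    rw [lintegral_add_left measurable_const, lintegral_const, measure_univ]
    finiteness
  set a : Ω → ℝ≥0∞ := fun ω => ∫⁻ v, f v ∂(jumpMeasure fun r => H r ω) with ha
  set a' : Ω → ℝ≥0∞ := fun ω => ∫⁻ v, l v ∂(jumpMeasure fun r => H r ω) with ha'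
  set b : Ω → ℝ≥0∞ := fun ω => ∫⁻ v, f v ∂intensityMeasure (hawkesRate c φ H) ω with hb
  set b' : Ω → ℝ≥0∞ := fun ω => ∫⁻ v, l v ∂intensityMeasure (hawkesRate c φ H) ω with hb'
  have ham : Measurable a := hΛ.measurable_jump (F := fun p => f p.2) (by fun_prop)
  have ham' : Measurable a' := hΛ.measurable_jump (F := fun p => l p.2) (by fun_prop)
  have hbm : Measurable b := hΛ.measurable_intensity (F := fun p => f p.2) (by fun_prop)
  have hbm' : Measurable b' := hΛ.measurable_intensity (F := fun p => l p.2) (by fun_prop)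
  have haY : ∀ ω, a ω ≤ D * Y ω := fun ω => lintegral_le_mul_measure_Iic _ hfD hfT
  have haY' : ∀ ω, a' ω ≤ D * Y ω := fun ω => lintegral_le_mul_measure_Iic _ hlD hlT
  have haZ : ∀ ω, a ω ≤ Z ω := fun ω => (haY ω).trans le_self_add
  have haZ' : ∀ ω, a' ω ≤ Z ω := fun ω => (haY' ω).trans le_self_add
  -- The compensator integral is controlled by the jump integral through the renewal identity `a + κ
  -- = N(g) + b`.
  have hbZ : ∀ ω, b ω ≤ Z ω := fun ω => by
    have h2 : b ω ≤ a ω + κ := le_add_self.trans_eq (haddg ω).symm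
    exact h2.trans (add_le_add (haY ω) le_self_add)
  have hbZ' : ∀ ω, b' ω ≤ Z ω := fun ω => by
    have h2 : b' ω ≤ a' ω + κ' := le_add_self.trans_eq (haddk ω).symm
    exact h2.trans (add_le_add (haY' ω) le_add_self)
  have hEfin : ∀ p : Ω → ℝ≥0∞, (∀ ω, p ω ≤ Z ω) → ∫⁻ ω, p ω ∂P ≠ ∞ := fun p hp =>
    ne_top_of_le_ne_top hEZ (lintegral_mono hp)
  have hEEfin : ∀ p p' : Ω → ℝ≥0∞, (∀ ω, p ω ≤ Z ω) → (∀ ω, p' ω ≤ Z ω) →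
      ∫⁻ ω, p ω * p' ω ∂P ≠ ∞ := fun p p' hp hp' =>
    ne_top_of_le_ne_top hEZZ (lintegral_mono fun ω => mul_le_mul' (hp ω) (hp' ω))
  have hmf := measurable_comp_snd_predictableSpace (Ω := Ω) (ℱ := ℱ) hfm
  have hml := measurable_comp_snd_predictableSpace (Ω := Ω) (ℱ := ℱ) hlm
  have hEa : ∫⁻ ω, a ω ∂P = ∫⁻ ω, b ω ∂P := hΛ.compensate hmf
  have hEa' : ∫⁻ ω, a' ω ∂P = ∫⁻ ω, b' ω ∂P := hΛ.compensate hml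
  have hstar : ∫⁻ ω, a ω * a' ω ∂P + ∫⁻ ω, b ω * b' ω ∂P
      = ∫⁻ ω, ∫⁻ v, f v * l v ∂(jumpMeasure fun r => H r ω) ∂P
        + ∫⁻ ω, a ω * b' ω ∂P + ∫⁻ ω, b ω * a' ω ∂P :=
    hΛ.lintegral_mul_add_lintegral_mul hmf hml
  -- the first moment formula for `f * l`
  have hfl : ∫⁻ ω, ∫⁻ v, f v * l v ∂(jumpMeasure fun r => H r ω) ∂P
      = c * ∫⁻ v in Ioi (0 : ℝ), f v * l v * renewalDensity φ v := by
    -- Jumps occur only at positive times, so cutting off the negative half-line changes no jump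
    -- integral and lets the duality with `renewalDensity` apply.
    set w : ℝ → ℝ≥0∞ := (Ioi 0).indicator fun v => f v * l v with hw
    have hwm : Measurable w := Measurable.indicator (by fun_prop) measurableSet_Ioi
    have hw0 : ∀ u ≤ 0, w u = 0 := fun u hu => indicator_of_notMem (not_lt.2 hu) _
    have hwfl : ∀ v, w v ≤ f v * l v := fun v => indicator_le_self _ _ v
    have h2 : ∀ ω, ∫⁻ v, f v * l v ∂(jumpMeasure fun r => H r ω)
        = ∫⁻ v, w v ∂(jumpMeasure fun r => H r ω) := by
      intro ω
      refine lintegral_congr_ae ?_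
      filter_upwards [(hΛ.path ω).ae_jumpMeasure_pos] with v hv
      rw [hw, indicator_of_mem (by exact hv)]
    simp_rw [h2]
    rw [hΛ.lintegral_jumpMeasure_of_le hφ h0 h1 hwm (C := D * D) (T := T)
      (ENNReal.mul_ne_top hDtop hDtop)
      (fun v => (hwfl v).trans (mul_le_mul' (hfD v) (hlD v)))
      (fun v hv => le_antisymm ((hwfl v).trans (by simp [hfT v hv])) zero_le),
      lintegral_renewalTransform hφ hwm hw0]
    congr 1
    refine setLIntegral_congr_fun measurableSet_Ioi fun v hv => ?_
    simp only [hw]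
    rw [indicator_of_mem hv]
  -- Pointwise expansion of `(a - b + κ) (a' - b' + κ')`. In the mean, `a - b` and `a' - b'` vanish
  -- and their product gives the diagonal term.
  have hpt := lintegral_congr (μ := P) fun ω => ENNReal.mul_add_eq_of_add_eq
    (ne_top_of_le_ne_top (hZtop ω) (haZ ω)) (ne_top_of_le_ne_top (hZtop ω) (hbZ ω)) hκtop
    (ne_top_of_le_ne_top (hZtop ω) (haZ' ω)) (ne_top_of_le_ne_top (hZtop ω) (hbZ' ω)) hκtop'
    (haddg ω) (haddk ω)
  rw [lintegral_add_right _ (by fun_prop), lintegral_add_left (by fun_prop),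
    lintegral_add_left (by fun_prop), lintegral_add_left (by fun_prop),
    lintegral_add_left (by fun_prop), lintegral_add_left (by fun_prop),
    lintegral_add_left (by fun_prop), lintegral_add_left (by fun_prop),
    lintegral_const_mul _ hbm, lintegral_const_mul _ hbm', lintegral_const_mul _ ham,
    lintegral_const_mul _ ham', lintegral_const, measure_univ, hstar, hEa, hEa', hfl] at hpt
  have hfin : ∫⁻ ω, a ω * b' ω ∂P + ∫⁻ ω, b ω * a' ω ∂P + κ * ∫⁻ ω, b' ω ∂P
      + κ' * ∫⁻ ω, b ω ∂P ≠ ∞ := by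
    have f1 := hEEfin a b' haZ hbZ'
    have f2 := hEEfin b a' hbZ haZ'
    have f3 := hEfin b hbZ
    have f4 := hEfin b' hbZ'
    finiteness
  refine (ENNReal.add_left_inj hfin).1 (hpt.trans ?_)
  ring

end Bounded

end HasPredictableIntensity

end HawkesMoments

/-! ### Passage to unbounded weights by monotone truncation. -/

lemma ENNReal.iSup_mul_iSup_of_monotone_seq {x y : ℕ → ℝ≥0∞} (hx : Monotone x) (hy : Monotone y) :
    (⨆ n, x n) * ⨆ n, y n = ⨆ n, x n * y n := by
  refine le_antisymm ?_ (iSup_le fun n => mul_le_mul' (le_iSup x n) (le_iSup y n))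
  rw [ENNReal.iSup_mul]
  refine iSup_le fun i => ?_
  rw [ENNReal.mul_iSup]
  refine iSup_le fun j => le_iSup_of_le (max i j) ?_
  exact mul_le_mul' (hx (le_max_left _ _)) (hy (le_max_right _ _))

lemma ENNReal.iSup_min_natCast_eq (a : ℝ≥0∞) : ⨆ n : ℕ, min a n = a := by
  rw [← inf_iSup_eq, ENNReal.iSup_natCast, inf_top_eq]

lemma renewalTransform_iSup {φ : ℝ → ℝ≥0∞} (hφ : Measurable φ) {g : ℕ → ℝ → ℝ≥0∞}
    (hg : ∀ n, Measurable (g n)) (hmono : Monotone g) (v : ℝ) :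
    ⨆ n, renewalTransform φ (g n) v = renewalTransform φ (fun y => ⨆ n, g n y) v := by
  have hψ := measurable_convResolvent hφ
  have hmono' : Monotone fun n => fun y => g n y * convResolvent φ (y - v) :=
    fun n m hnm y => mul_le_mul_left (hmono hnm y) _
  simp only [renewalTransform, ENNReal.iSup_mul]
  rw [lintegral_iSup (fun n => by have := hg n; fun_prop) hmono',
    ENNReal.iSup_add_iSup_of_monotone (fun n m hnm => hmono hnm v)
      (fun n m hnm => lintegral_mono (hmono' hnm))]

section HawkesMoments

variable {Ω : Type*} {mΩ : MeasurableSpace Ω} {P : Measure Ω} [IsProbabilityMeasure P]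
  {ℱ : Filtration ℝ≥0 mΩ} {H : ℝ≥0 → Ω → ℕ} {c : ℝ≥0∞} {φ : ℝ → ℝ≥0∞}

namespace HasPredictableIntensity

/-- First moments of linear functionals of a Hawkes process. -/
theorem lintegral_jump (hΛ : HasPredictableIntensity P ℱ H (hawkesRate c φ H))
    (hφ : Measurable φ) (h0 : ∀ t ≤ 0, φ t = 0) (h1 : ∫⁻ t, φ t < 1) {g : ℝ → ℝ≥0∞}
    (hg : Measurable g) {T : ℝ} (hgT : ∀ v, T < v → g v = 0) :
    ∫⁻ ω, ∫⁻ v, g v ∂(jumpMeasure fun r => H r ω) ∂P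
      = c * ∫⁻ v in Ioi (0 : ℝ), renewalTransform φ g v := by
  -- The weight `φ (t - ·)` of the intensity may be unbounded. Both sides are monotone in the
  -- weight, so suprema over the truncations give the formula, possibly with infinite values.
  set gn : ℕ → ℝ → ℝ≥0∞ := fun n v => min (g v) n with hgn
  have hgm : ∀ n, Measurable (gn n) := fun n => hg.min measurable_const
  have hmono : Monotone gn := fun n m hnm v => min_le_min le_rfl (by exact_mod_cast hnm)
  have hsup : (fun v => ⨆ n, gn n v) = g := funext fun v => ENNReal.iSup_min_natCast_eq (g v)
  have hRm : ∀ n, Measurable (renewalTransform φ (gn n)) := fun n =>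
    measurable_renewalTransform hφ (hgm n)
  have hRmono : Monotone fun n => renewalTransform φ (gn n) := fun n m hnm v =>
    add_le_add (hmono hnm v) (lintegral_mono fun y => mul_le_mul_left (hmono hnm y) _)
  have hb := fun n => hΛ.lintegral_jumpMeasure_of_le hφ h0 h1 (hgm n) (C := n) (T := T)
    (ENNReal.natCast_ne_top n) (fun v => min_le_right _ _) (fun v hv => by simp [hgn, hgT v hv])
  have hJ : ∀ ω, ⨆ n, ∫⁻ v, gn n v ∂(jumpMeasure fun r => H r ω)
      = ∫⁻ v, g v ∂(jumpMeasure fun r => H r ω) := fun ω => by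
    rw [← lintegral_iSup hgm hmono]
    exact lintegral_congr fun v => ENNReal.iSup_min_natCast_eq (g v)
  simp_rw [← hJ]
  rw [lintegral_iSup (fun n => hΛ.measurable_jump (F := fun p => gn n p.2) (by have := hgm n; fun_prop))
    (fun n m hnm ω => lintegral_mono (hmono hnm))]
  simp_rw [hb]
  rw [← ENNReal.mul_iSup, ← lintegral_iSup hRm hRmono]
  simp_rw [renewalTransform_iSup hφ hgm hmono, hsup]

/-- Mixed second moments of linear functionals of a Hawkes process. -/
theorem lintegral_jump_mul_jump (hΛ : HasPredictableIntensity P ℱ H (hawkesRate c φ H))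
    (hφ : Measurable φ) (h0 : ∀ t ≤ 0, φ t = 0) (h1 : ∫⁻ t, φ t < 1) (hc : c ≠ ∞)
    {g k : ℝ → ℝ≥0∞} (hg : Measurable g) (hk : Measurable k) {T : ℝ}
    (hgT : ∀ v, T < v → g v = 0) (hkT : ∀ v, T < v → k v = 0) :
    ∫⁻ ω, (∫⁻ v, g v ∂(jumpMeasure fun r => H r ω)) * ∫⁻ v, k v ∂(jumpMeasure fun r => H r ω) ∂P
      = (c * ∫⁻ v in Ioi (0 : ℝ), renewalTransform φ g v) *
          (c * ∫⁻ v in Ioi (0 : ℝ), renewalTransform φ k v)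
        + c * ∫⁻ v in Ioi (0 : ℝ),
            renewalTransform φ g v * renewalTransform φ k v * renewalDensity φ v := by
  have hmm := measurable_renewalDensity hφ
  set tr : (ℝ → ℝ≥0∞) → ℕ → ℝ → ℝ≥0∞ := fun g n v => min (g v) n with htr
  have htm : ∀ {g : ℝ → ℝ≥0∞}, Measurable g → ∀ n, Measurable (tr g n) :=
    fun hg n => hg.min measurable_const
  have hmono : ∀ g, Monotone (tr g) := fun g n m hnm v =>
    min_le_min le_rfl (by exact_mod_cast hnm)
  have hsup : ∀ g : ℝ → ℝ≥0∞, (fun v => ⨆ n, tr g n v) = g :=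
    fun g => funext fun v => ENNReal.iSup_min_natCast_eq (g v)
  have hRm : ∀ {g : ℝ → ℝ≥0∞}, Measurable g → ∀ n, Measurable (renewalTransform φ (tr g n)) :=
    fun hg n => measurable_renewalTransform hφ (htm hg n)
  have hRmono : ∀ g, Monotone fun n => renewalTransform φ (tr g n) := fun g n m hnm v =>
    add_le_add (hmono g hnm v) (lintegral_mono fun y => mul_le_mul_left (hmono g hnm y) _)
  have hRsup : ∀ {g : ℝ → ℝ≥0∞}, Measurable g → ∀ v,
      ⨆ n, renewalTransform φ (tr g n) v = renewalTransform φ g v := fun {g} hg v => by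
    rw [renewalTransform_iSup hφ (htm hg) (hmono g), hsup g]
  have hJ : ∀ {g : ℝ → ℝ≥0∞}, Measurable g → ∀ ω,
      ⨆ n, ∫⁻ v, tr g n v ∂(jumpMeasure fun r => H r ω)
        = ∫⁻ v, g v ∂(jumpMeasure fun r => H r ω) := fun {g} hg ω => by
    rw [← lintegral_iSup (htm hg) (hmono g)]
    exact lintegral_congr fun v => ENNReal.iSup_min_natCast_eq (g v)
  have hJmono : ∀ g ω, Monotone fun n => ∫⁻ v, tr g n v ∂(jumpMeasure fun r => H r ω) :=
    fun g ω n m hnm => lintegral_mono (hmono g hnm)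
  have hJm : ∀ {g : ℝ → ℝ≥0∞}, Measurable g → ∀ n,
      Measurable fun ω => ∫⁻ v, tr g n v ∂(jumpMeasure fun r => H r ω) := fun {g} hg n =>
    hΛ.measurable_jump (F := fun p => tr g n p.2) (by have := htm hg n; fun_prop)
  have hb := fun n => hΛ.lintegral_jump_mul_jump_of_le hφ h0 h1 hc (htm hg n) (htm hk n) (C := n)
    (T := T) (ENNReal.natCast_ne_top n) (fun v => min_le_right _ _) (fun v => min_le_right _ _)
    (fun v hv => by simp [htr, hgT v hv]) (fun v hv => by simp [htr, hkT v hv])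
  have hIsup : ∀ {g : ℝ → ℝ≥0∞}, Measurable g →
      ⨆ n, c * ∫⁻ v in Ioi (0 : ℝ), renewalTransform φ (tr g n) v
        = c * ∫⁻ v in Ioi (0 : ℝ), renewalTransform φ g v := fun {g} hg => by
    rw [← ENNReal.mul_iSup, ← lintegral_iSup (hRm hg) (hRmono g)]
    simp_rw [hRsup hg]
  have hIm : ∀ g, Monotone fun n => c * ∫⁻ v in Ioi (0 : ℝ), renewalTransform φ (tr g n) v :=
    fun g n m hnm => mul_le_mul_right (lintegral_mono (hRmono g hnm)) _
  have hprod : Monotone fun n => fun v =>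
      renewalTransform φ (tr g n) v * renewalTransform φ (tr k n) v * renewalDensity φ v :=
    fun n m hnm v => mul_le_mul_left (mul_le_mul' (hRmono g hnm v) (hRmono k hnm v)) _
  have hV : ⨆ n, c * ∫⁻ v in Ioi (0 : ℝ),
        renewalTransform φ (tr g n) v * renewalTransform φ (tr k n) v * renewalDensity φ v
      = c * ∫⁻ v in Ioi (0 : ℝ),
        renewalTransform φ g v * renewalTransform φ k v * renewalDensity φ v := by
    have hm : ∀ n, Measurable fun v =>
        renewalTransform φ (tr g n) v * renewalTransform φ (tr k n) v * renewalDensity φ v :=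
      fun n => ((hRm hg n).mul (hRm hk n)).mul hmm
    rw [← ENNReal.mul_iSup, ← lintegral_iSup hm hprod]
    congr 1
    refine lintegral_congr fun v => ?_
    rw [← ENNReal.iSup_mul, ← ENNReal.iSup_mul_iSup_of_monotone_seq
      (fun n m hnm => hRmono g hnm v) (fun n m hnm => hRmono k hnm v), hRsup hg, hRsup hk]
  calc _ = ∫⁻ ω, ⨆ n, (∫⁻ v, tr g n v ∂(jumpMeasure fun r => H r ω)) *
        ∫⁻ v, tr k n v ∂(jumpMeasure fun r => H r ω) ∂P := by
        refine lintegral_congr fun ω => ?_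
        rw [← ENNReal.iSup_mul_iSup_of_monotone_seq (hJmono g ω) (hJmono k ω), hJ hg, hJ hk]
    _ = _ := by
        have hm : ∀ n, Measurable fun ω => (∫⁻ v, tr g n v ∂(jumpMeasure fun r => H r ω)) *
            ∫⁻ v, tr k n v ∂(jumpMeasure fun r => H r ω) :=
          fun n => (hJm hg n).mul (hJm hk n)
        rw [lintegral_iSup hm
          (fun n m hnm ω => mul_le_mul' (hJmono g ω hnm) (hJmono k ω hnm))]
        simp_rw [hb]
        rw [← ENNReal.iSup_add_iSup_of_monotone
            (fun n m hnm => mul_le_mul' (hIm g hnm) (hIm k hnm))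
            (fun n m hnm => mul_le_mul_right (lintegral_mono (hprod hnm)) _), hV,
          ← ENNReal.iSup_mul_iSup_of_monotone_seq (hIm g) (hIm k), hIsup hg, hIsup hk]

/-- Mixed second moments of affine functionals of a Hawkes process. -/
theorem lintegral_affine_mul_affine (hΛ : HasPredictableIntensity P ℱ H (hawkesRate c φ H))
    (hφ : Measurable φ) (h0 : ∀ t ≤ 0, φ t = 0) (h1 : ∫⁻ t, φ t < 1) (hc : c ≠ ∞)
    {g k : ℝ → ℝ≥0∞} (hg : Measurable g) (hk : Measurable k) {T : ℝ}
    (hgT : ∀ v, T < v → g v = 0) (hkT : ∀ v, T < v → k v = 0) (d e : ℝ≥0∞) :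
    ∫⁻ ω, (d + ∫⁻ v, g v ∂(jumpMeasure fun r => H r ω)) *
        (e + ∫⁻ v, k v ∂(jumpMeasure fun r => H r ω)) ∂P
      = (∫⁻ ω, d + ∫⁻ v, g v ∂(jumpMeasure fun r => H r ω) ∂P) *
          (∫⁻ ω, e + ∫⁻ v, k v ∂(jumpMeasure fun r => H r ω) ∂P)
        + c * ∫⁻ v in Ioi (0 : ℝ),
            renewalTransform φ g v * renewalTransform φ k v * renewalDensity φ v := by
  have hgm : Measurable fun ω => ∫⁻ v, g v ∂(jumpMeasure fun r => H r ω) :=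
    hΛ.measurable_jump (F := fun p => g p.2) (by fun_prop)
  have hkm : Measurable fun ω => ∫⁻ v, k v ∂(jumpMeasure fun r => H r ω) :=
    hΛ.measurable_jump (F := fun p => k p.2) (by fun_prop)
  -- Constants do not affect the covariance term. Only sums and products occur, so nothing has to be
  -- finite here.
  have hexp : ∀ ω, (d + ∫⁻ v, g v ∂(jumpMeasure fun r => H r ω)) *
        (e + ∫⁻ v, k v ∂(jumpMeasure fun r => H r ω))
      = d * e + d * (∫⁻ v, k v ∂(jumpMeasure fun r => H r ω))
        + e * (∫⁻ v, g v ∂(jumpMeasure fun r => H r ω))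
        + (∫⁻ v, g v ∂(jumpMeasure fun r => H r ω)) *
          ∫⁻ v, k v ∂(jumpMeasure fun r => H r ω) := fun ω => by ring
  simp_rw [hexp]
  rw [lintegral_add_left (by fun_prop), lintegral_add_left (by fun_prop),
    lintegral_add_left (by fun_prop), lintegral_add_left (by fun_prop),
    lintegral_add_left (by fun_prop), lintegral_const_mul _ hkm, lintegral_const_mul _ hgm,
    hΛ.lintegral_jump_mul_jump hφ h0 h1 hc hg hk hgT hkT, hΛ.lintegral_jump hφ h0 h1 hg hgT,
    hΛ.lintegral_jump hφ h0 h1 hk hkT]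
  simp only [lintegral_const, measure_univ, mul_one]
  ring

end HasPredictableIntensity

end HawkesMoments

/-! ### From extended nonnegative to real moments -/

section RealMoments

variable {Ω : Type*} {mΩ : MeasurableSpace Ω} {P : Measure Ω}

/-- `X` is almost surely nonnegative and represented by the measurable function `A`. -/
structure IsENNRealVersion (P : Measure Ω) (X : Ω → ℝ) (A : Ω → ℝ≥0∞) : Prop where
  measurable : Measurable A
  ae_eq : ∀ᵐ ω ∂P, 0 ≤ X ω ∧ ENNReal.ofReal (X ω) = A ω

namespace IsENNRealVersion

variable {X Y : Ω → ℝ} {A B : Ω → ℝ≥0∞}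

lemma lintegral_ofReal (h : IsENNRealVersion P X A) :
    ∫⁻ ω, ENNReal.ofReal (X ω) ∂P = ∫⁻ ω, A ω ∂P :=
  lintegral_congr_ae (h.ae_eq.mono fun _ hω => hω.2)

lemma ae_eq_toReal (h : IsENNRealVersion P X A) : X =ᵐ[P] fun ω => (A ω).toReal :=
  h.ae_eq.mono fun ω hω => by
    dsimp only
    rw [← hω.2, ENNReal.toReal_ofReal hω.1]

lemma aestronglyMeasurable (h : IsENNRealVersion P X A) : AEStronglyMeasurable X P :=
  ⟨_, h.measurable.ennreal_toReal.stronglyMeasurable, h.ae_eq_toReal⟩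

lemma integrable_iff (h : IsENNRealVersion P X A) : Integrable X P ↔ ∫⁻ ω, A ω ∂P ≠ ∞ := by
  rw [← h.lintegral_ofReal]
  exact (lintegral_ofReal_ne_top_iff_integrable h.aestronglyMeasurable
    (h.ae_eq.mono fun _ hω => hω.1)).symm

lemma integral_eq (h : IsENNRealVersion P X A) : ∫ ω, X ω ∂P = (∫⁻ ω, A ω ∂P).toReal := by
  rw [integral_eq_lintegral_of_nonneg_ae (h.ae_eq.mono fun _ hω => hω.1) h.aestronglyMeasurable,
    h.lintegral_ofReal]

lemma mul (h : IsENNRealVersion P X A) (h' : IsENNRealVersion P Y B) :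
    IsENNRealVersion P (fun ω => X ω * Y ω) fun ω => A ω * B ω where
  measurable := h.measurable.mul h'.measurable
  ae_eq := by
    filter_upwards [h.ae_eq, h'.ae_eq] with ω h1 h2
    exact ⟨mul_nonneg h1.1 h2.1, by rw [ENNReal.ofReal_mul h1.1, h1.2, h2.2]⟩

/-- Product moments and covariance from the extended nonnegative second moment. -/
lemma covariance_eq [IsProbabilityMeasure P] (h : IsENNRealVersion P X A)
    (h' : IsENNRealVersion P Y B) (hA : ∫⁻ ω, A ω ∂P ≠ ∞) (hB : ∫⁻ ω, B ω ∂P ≠ ∞) {V : ℝ≥0∞}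
    (hV : ∫⁻ ω, A ω * B ω ∂P = (∫⁻ ω, A ω ∂P) * (∫⁻ ω, B ω ∂P) + V) :
    ∫⁻ ω, ENNReal.ofReal (X ω * Y ω) ∂P
        = ENNReal.ofReal ((∫ ω, X ω ∂P) * (∫ ω, Y ω ∂P)) + V ∧
    (Integrable (fun ω => X ω * Y ω) P ↔ V ≠ ∞) ∧
    (V ≠ ∞ → covariance X Y P = (∫ ω, X ω * Y ω ∂P) - (∫ ω, X ω ∂P) * (∫ ω, Y ω ∂P) ∧
      covariance X Y P = V.toReal) := by
  have hAB : (∫⁻ ω, A ω ∂P) * (∫⁻ ω, B ω ∂P) ≠ ∞ := ENNReal.mul_ne_top hA hB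
  -- The product of the means is finite, so integrability of `X * Y` is decided by `V` alone.
  have hiff : Integrable (fun ω => X ω * Y ω) P ↔ V ≠ ∞ := by
    rw [(h.mul h').integrable_iff, hV, ENNReal.add_ne_top]
    exact and_iff_right hAB
  refine ⟨?_, hiff, fun hVt => ?_⟩
  · rw [(h.mul h').lintegral_ofReal, hV, h.integral_eq, h'.integral_eq, ← ENNReal.toReal_mul,
      ENNReal.ofReal_toReal hAB]
  · have hX := h.integrable_iff.2 hA
    have hY := h'.integrable_iff.2 hB
    have hXY := hiff.2 hVt
    have hcov : covariance X Y P
        = (∫ ω, X ω * Y ω ∂P) - (∫ ω, X ω ∂P) * (∫ ω, Y ω ∂P) := by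
      have hexp : ∀ ω, (X ω - ∫ ω, X ω ∂P) * (Y ω - ∫ ω, Y ω ∂P)
          = X ω * Y ω - (∫ ω, Y ω ∂P) * X ω - ((∫ ω, X ω ∂P) * Y ω
            - (∫ ω, X ω ∂P) * ∫ ω, Y ω ∂P) := fun ω => by ring
      simp only [covariance, hexp]
      have i1 : Integrable (fun ω => (∫ ω, Y ω ∂P) * X ω) P := hX.const_mul _
      have i2 : Integrable (fun ω => (∫ ω, X ω ∂P) * Y ω) P := hY.const_mul _
      have i3 : Integrable (fun ω => X ω * Y ω - (∫ ω, Y ω ∂P) * X ω) P := hXY.sub i1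
      have i4 : Integrable (fun ω => (∫ ω, X ω ∂P) * Y ω - (∫ ω, X ω ∂P) * ∫ ω, Y ω ∂P) P :=
        i2.sub (integrable_const _)
      rw [integral_sub i3 i4,
        integral_sub hXY i1, integral_sub i2 (integrable_const _),
        integral_const_mul, integral_const_mul, integral_const]
      simp
      ring
    refine ⟨hcov, ?_⟩
    rw [hcov, (h.mul h').integral_eq, hV, ENNReal.toReal_add hAB hVt, ENNReal.toReal_mul,
      h.integral_eq, h'.integral_eq]
    ring

end IsENNRealVersion

end RealMoments

/-! ### The transforms of the two weights, and translation into `hawkesPsi`. -/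

/-- The renewal function `1 + ∫_{z ≤ x} ψ z dz`, where `ψ` is the resolvent of `φ`. -/
noncomputable def renewalMass (φ : ℝ → ℝ≥0∞) (x : ℝ) : ℝ≥0∞ :=
  1 + ∫⁻ z in Iic x, convResolvent φ z

lemma renewalDensity_eq_renewalMass (φ : ℝ → ℝ≥0∞) (y : ℝ) :
    renewalDensity φ y = renewalMass φ y := by
  rw [renewalDensity, renewalMass, Measure.restrict_congr_set Iio_ae_eq_Iic.symm,
    ← lintegral_indicator measurableSet_Ioi, ← lintegral_indicator measurableSet_Iio,
    ← lintegral_sub_left_eq_self ((Iio y).indicator _) y]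
  congr 1
  refine lintegral_congr fun v => ?_
  by_cases hv : 0 < v
  · rw [indicator_of_mem (by exact hv), indicator_of_mem (by simpa using hv)]
  · rw [indicator_of_notMem (by exact hv), indicator_of_notMem (by simpa using hv)]

lemma setLIntegral_Ioi_eq_Ioc {K : ℝ → ℝ≥0∞} {s : ℝ} (hK : ∀ v, s < v → K v = 0) :
    ∫⁻ v in Ioi (0 : ℝ), K v = ∫⁻ v in Ioc 0 s, K v := by
  rw [← lintegral_indicator measurableSet_Ioi, ← lintegral_indicator measurableSet_Ioc]
  refine lintegral_congr fun v => ?_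
  by_cases h0 : 0 < v
  · rw [indicator_of_mem (by exact h0)]
    by_cases hs : v ≤ s
    · rw [indicator_of_mem (by exact ⟨h0, hs⟩)]
    · rw [indicator_of_notMem (by exact fun h => hs h.2), hK v (not_le.1 hs)]
  · rw [indicator_of_notMem (by exact h0), indicator_of_notMem (by exact fun h => h0 h.1)]

/-- This is the resolvent equation at `t - v`, after translating the integration variable by `v`. -/
lemma renewalTransform_kernel {φ : ℝ → ℝ≥0∞} (hφ : Measurable φ) (t v : ℝ) :
    renewalTransform φ (fun y => φ (t - y)) v = convResolvent φ (t - v) := by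
  rw [renewalTransform, convResolvent_eq hφ,
    ← lintegral_sub_right_eq_self (fun z => φ (t - v - z) * convResolvent φ z) v]
  congr 1
  refine lintegral_congr fun y => ?_
  congr 2
  ring

namespace IsBorelVersion

variable {Φ : ℝ → ℝ} {φ : ℝ → ℝ≥0∞}

lemma renewalTransform_indicator (h : IsBorelVersion Φ φ) (s v : ℝ) :
    renewalTransform φ ((Iic s).indicator 1) v
      = (Iic s).indicator (fun v => renewalMass φ (s - v)) v := by
  by_cases hv : v ≤ s
  · rw [indicator_of_mem (by exact hv), renewalTransform, indicator_of_mem (by exact hv),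
      renewalMass, ← lintegral_indicator measurableSet_Iic,
      ← lintegral_sub_right_eq_self ((Iic (s - v)).indicator _) v]
    congr 1
    refine lintegral_congr fun y => ?_
    by_cases hy : y ≤ s
    · rw [indicator_of_mem (by exact hy), indicator_of_mem (by simpa using hy), Pi.one_apply,
        one_mul]
    · rw [indicator_of_notMem (by exact hy), indicator_of_notMem (by simpa using hy), zero_mul]
  · rw [indicator_of_notMem (by exact hv)]
    refine renewalTransform_of_lt h.zero (T := s) (fun u hu => ?_) (not_le.1 hv)
    exact indicator_of_notMem (s := Iic s) (not_le.2 hu) _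

lemma renewalMass_le (φ : ℝ → ℝ≥0∞) (x : ℝ) :
    renewalMass φ x ≤ 1 + ∫⁻ z, convResolvent φ z :=
  add_le_add le_rfl (setLIntegral_le_lintegral _ _)

lemma one_add_lintegral_convResolvent_ne_top (h : IsBorelVersion Φ φ) :
    1 + ∫⁻ z, convResolvent φ z ≠ ∞ :=
  ENNReal.add_ne_top.2 ⟨ENNReal.one_ne_top,
    (lintegral_convResolvent_lt_top h.measurable h.lintegral_lt_one).ne⟩

lemma renewalMass_ne_top (h : IsBorelVersion Φ φ) (x : ℝ) : renewalMass φ x ≠ ∞ :=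
  ne_top_of_le_ne_top h.one_add_lintegral_convResolvent_ne_top (renewalMass_le φ x)

lemma measurable_renewalMass (h : IsBorelVersion Φ φ) : Measurable (renewalMass φ) := by
  have := measurable_renewalDensity h.measurable
  rwa [funext (renewalDensity_eq_renewalMass φ)] at this

lemma toReal_renewalMass (h : IsBorelVersion Φ φ) (hΦ : ∀ u, 0 ≤ u → 0 ≤ Φ u) {x : ℝ}
    (hx : 0 ≤ x) : (renewalMass φ x).toReal = 1 + ∫ w in (0 : ℝ)..x, hawkesPsi Φ w := by
  have hψ := measurable_convResolvent h.measurable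
  rw [intervalIntegral.integral_of_le hx,
    integral_congr_ae (g := fun w => (convResolvent φ w).toReal), integral_toReal, renewalMass,
    ENNReal.toReal_add ENNReal.one_ne_top, ENNReal.toReal_one]
  · congr 2
    rw [← lintegral_indicator measurableSet_Iic, ← lintegral_indicator measurableSet_Ioc]
    refine lintegral_congr fun w => ?_
    by_cases hw : 0 < w
    · simp [indicator_apply, hw]
    · simp [indicator_apply, convResolvent_of_nonpos h.zero (not_lt.1 hw)]
  · exact ((setLIntegral_le_lintegral _ _).trans_lt
      (lintegral_convResolvent_lt_top h.measurable h.lintegral_lt_one)).ne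
  · exact hψ.aemeasurable
  · exact ae_restrict_of_ae h.convResolvent_lt_top
  · rw [Filter.EventuallyEq, ae_restrict_iff' measurableSet_Ioc]
    filter_upwards [h.hawkesPsi_ae_eq hΦ] with w hw hmem
    exact hw hmem.1

lemma hawkesPsi_sub_ae (h : IsBorelVersion Φ φ) (hΦ : ∀ u, 0 ≤ u → 0 ≤ Φ u) {s t : ℝ}
    (hst : s ≤ t) : ∀ᵐ v ∂volume.restrict (Ioc 0 s), 0 ≤ hawkesPsi Φ (t - v) ∧
      ENNReal.ofReal (hawkesPsi Φ (t - v)) = convResolvent φ (t - v) := by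
  -- When `s = t` the point `v = s` gives the argument `0`, where `hawkesPsi` is not controlled.
  have hne : ∀ᵐ v : ℝ, v ≠ s := by simp [ae_iff]
  have hq := (Measure.measurePreserving_sub_left volume t).quasiMeasurePreserving
  rw [ae_restrict_iff' measurableSet_Ioc]
  filter_upwards [hne, hq.ae (h.hawkesPsi_ae_eq hΦ), hq.ae h.convResolvent_lt_top]
    with v h1 h2 h3 hmem
  have hlt : v < s := lt_of_le_of_ne hmem.2 h1
  rw [h2 (by linarith), ENNReal.ofReal_toReal h3.ne]
  exact ⟨ENNReal.toReal_nonneg, rfl⟩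

/-- Here the measure is Lebesgue measure on `(0, s]` instead of a probability: the same predicate
converts the time integrals in the covariance formulas. -/
lemma isENNRealVersion_hawkesPsi_sub (h : IsBorelVersion Φ φ) (hΦ : ∀ u, 0 ≤ u → 0 ≤ Φ u)
    {s t : ℝ} (hst : s ≤ t) : IsENNRealVersion (volume.restrict (Ioc 0 s))
      (fun v => hawkesPsi Φ (t - v)) fun v => convResolvent φ (t - v) where
  measurable := (measurable_convResolvent h.measurable).comp (measurable_const.sub measurable_id)
  ae_eq := h.hawkesPsi_sub_ae hΦ hst

lemma ofReal_one_add_integral (h : IsBorelVersion Φ φ) (hΦ : ∀ u, 0 ≤ u → 0 ≤ Φ u) {x : ℝ}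
    (hx : 0 ≤ x) : 0 ≤ 1 + ∫ w in (0 : ℝ)..x, hawkesPsi Φ w ∧
      ENNReal.ofReal (1 + ∫ w in (0 : ℝ)..x, hawkesPsi Φ w) = renewalMass φ x := by
  rw [← h.toReal_renewalMass hΦ hx]
  exact ⟨ENNReal.toReal_nonneg, ENNReal.ofReal_toReal (h.renewalMass_ne_top x)⟩

lemma isENNRealVersion_renewalMass (h : IsBorelVersion Φ φ) (hΦ : ∀ u, 0 ≤ u → 0 ≤ Φ u)
    (s : ℝ) : IsENNRealVersion (volume.restrict (Ioc 0 s))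
      (fun v => 1 + ∫ w in (0 : ℝ)..v, hawkesPsi Φ w) (renewalMass φ) where
  measurable := h.measurable_renewalMass
  ae_eq := by
    filter_upwards [ae_restrict_mem measurableSet_Ioc] with v hv
    exact h.ofReal_one_add_integral hΦ hv.1.le

lemma isENNRealVersion_renewalMass_sub (h : IsBorelVersion Φ φ) (hΦ : ∀ u, 0 ≤ u → 0 ≤ Φ u)
    {s t : ℝ} (hst : s ≤ t) : IsENNRealVersion (volume.restrict (Ioc 0 s))
      (fun v => 1 + ∫ y in v..t, hawkesPsi Φ (y - v)) fun v => renewalMass φ (t - v) where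
  measurable := h.measurable_renewalMass.comp (measurable_const.sub measurable_id)
  ae_eq := by
    filter_upwards [ae_restrict_mem measurableSet_Ioc] with v hv
    rw [intervalIntegral.integral_comp_sub_right, sub_self]
    exact h.ofReal_one_add_integral hΦ (sub_nonneg.2 (hv.2.trans hst))

end IsBorelVersion

/-! ### From the Hawkes process to the predictable setting. -/

section Representation

variable {Ω : Type*} {mΩ : MeasurableSpace Ω} {P : Measure Ω}
  {ℱ : Filtration ℝ≥0 mΩ} {H : ℝ≥0 → Ω → ℕ} {μ : ℝ} {Φ : ℝ → ℝ} {φ : ℝ → ℝ≥0∞}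

lemma ofReal_hawkesIntensity (hμ : 0 ≤ μ) (hΦ : ∀ u, 0 ≤ u → 0 ≤ Φ u)
    (hφ : ∀ u ≤ 0, φ u = 0) {ω : Ω} (hω : IsCountingPath fun t => H t ω) {t : ℝ}
    (hφΦ : ∀ k, PassesLevel (fun r => H r ω) k → passageTime (fun r => H r ω) k < t →
      φ (t - passageTime (fun r => H r ω) k)
        = ENNReal.ofReal (Φ (t - passageTime (fun r => H r ω) k))) :
    0 ≤ hawkesIntensity μ Φ H t ω ∧
      ENNReal.ofReal (hawkesIntensity μ Φ H t ω) = hawkesRate (ENNReal.ofReal μ) φ H (ω, t) := by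
  have h1 := hω.ofReal_finsum_jumpTimes hΦ hφ hφΦ
  refine ⟨add_nonneg hμ h1.1, ?_⟩
  rw [hawkesIntensity, ENNReal.ofReal_add hμ h1.1, hawkesRate, h1.2]

namespace IsHawkesProcess

lemma hasPredictableIntensity (hH : IsHawkesProcess P ℱ μ Φ H) (hμ : 0 ≤ μ)
    (hΦ : ∀ u, 0 ≤ u → 0 ≤ Φ u) (h : IsBorelVersion Φ φ) :
    HasPredictableIntensity P ℱ H (hawkesRate (ENNReal.ofReal μ) φ H) where
  adapted := hH.adapted
  path := hH.countingPath
  integrable t := by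
    have := (hH.integrable t).hasFiniteIntegral
    rw [hasFiniteIntegral_iff_enorm] at this
    simpa using this.ne
  predictable := measurable_hawkesRate hH.adapted hH.countingPath _ h.measurable h.zero
  compensation s t hst A hA := by
    rw [hH.intensity s t hst A hA]
    refine lintegral_congr fun ω => lintegral_congr_ae (ae_restrict_of_ae ?_)
    -- A fixed path has countably many passage times, and each excludes only a null set of times
    -- `r`.
    have hk : ∀ᵐ r : ℝ, ∀ k : ℕ, 0 < r - passageTime (fun r => H r ω) k →
        φ (r - passageTime (fun r => H r ω) k)
          = ENNReal.ofReal (Φ (r - passageTime (fun r => H r ω) k)) :=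
      ae_all_iff.2 fun k =>
        (measurePreserving_sub_right volume _).quasiMeasurePreserving.ae h.ae_eq
    filter_upwards [hk] with r hr
    exact (ofReal_hawkesIntensity hμ hΦ h.zero (hH.countingPath ω)
      fun k _ hlt => hr k (sub_pos.2 hlt)).2

/-- The summand `0` presents the count as an affine functional of the jumps, parallel to the
intensity, whose constant is the baseline. -/
lemma isENNRealVersion_process (hH : IsHawkesProcess P ℱ μ Φ H) (t : ℝ≥0) :
    IsENNRealVersion P (fun ω => (H t ω : ℝ))
      fun ω => 0 + ∫⁻ v, (Iic (t : ℝ)).indicator 1 v ∂(jumpMeasure fun r => H r ω) where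
  measurable := measurable_const.add (measurable_lintegral_jumpMeasure
    (fun t => (hH.adapted t).mono (ℱ.le t) le_rfl) hH.countingPath
    (F := fun p => (Iic (t : ℝ)).indicator 1 p.2)
    ((measurable_one.indicator measurableSet_Iic).comp measurable_snd))
  ae_eq := by
    filter_upwards [hH.zero] with ω hω
    refine ⟨Nat.cast_nonneg _, ?_⟩
    have hae : (Iic (t : ℝ) : Set ℝ) =ᵐ[jumpMeasure fun r => H r ω] Ioc 0 (t : ℝ) := by
      filter_upwards [(hH.countingPath ω).ae_jumpMeasure_pos] with v hv
      exact propext ⟨fun h => ⟨hv, h⟩, fun h => h.2⟩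
    rw [zero_add, lintegral_indicator_one measurableSet_Iic, measure_congr hae,
      (hH.countingPath ω).jumpMeasure_Ioc]
    simp [hω]

/-- At a fixed time `t`, replacing `Φ` by `φ` matters only if some jump has its age `t - u` in a
given null set. The expected number of such jumps is, by compensation, an integral of the intensity
over a null set of times, hence zero. -/
lemma isENNRealVersion_intensity [IsProbabilityMeasure P] (hH : IsHawkesProcess P ℱ μ Φ H) (hμ : 0 ≤ μ)
    (hΦ : ∀ u, 0 ≤ u → 0 ≤ Φ u) (h : IsBorelVersion Φ φ) (t : ℝ) :
    IsENNRealVersion P (fun ω => hawkesIntensity μ Φ H t ω)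
      fun ω => ENNReal.ofReal μ + ∫⁻ v, φ (t - v) ∂(jumpMeasure fun r => H r ω) := by
  have hΛ := hH.hasPredictableIntensity hμ hΦ h
  have hm : Measurable fun ω => hawkesRate (ENNReal.ofReal μ) φ H (ω, t) :=
    hΛ.measurable.comp measurable_prodMk_right
  refine ⟨hm, ?_⟩
  set N := toMeasurable volume {x | ¬ (0 < x → φ x = ENNReal.ofReal (Φ x))} with hN
  have hN0 : volume N = 0 := by
    rw [hN, measure_toMeasurable]
    exact ae_iff.1 h.ae_eq
  have hNm : MeasurableSet N := measurableSet_toMeasurable _ _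
  have hBm : Measurable fun v : ℝ => N.indicator (1 : ℝ → ℝ≥0∞) (t - v) :=
    (measurable_one.indicator hNm).comp (measurable_const.sub measurable_id)
  have hE : ∫⁻ ω, ∫⁻ v, N.indicator (1 : ℝ → ℝ≥0∞) (t - v) ∂(jumpMeasure fun r => H r ω) ∂P = 0 := by
    have hc := hΛ.compensate (measurable_comp_snd_predictableSpace (Ω := Ω) (ℱ := ℱ) hBm)
    dsimp only at hc
    rw [hc]
    have hnull : ∀ᵐ v : ℝ, N.indicator (1 : ℝ → ℝ≥0∞) (t - v) = 0 := by
      have : ∀ᵐ x : ℝ, N.indicator (1 : ℝ → ℝ≥0∞) x = 0 := by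
        filter_upwards [measure_eq_zero_iff_ae_notMem.1 hN0] with x hx
        exact indicator_of_notMem hx _
      exact (Measure.measurePreserving_sub_left volume t).quasiMeasurePreserving.ae this
    rw [lintegral_eq_zero_of_ae_eq_zero]
    refine ae_of_all _ fun ω => ?_
    dsimp only [Pi.zero_apply]
    rw [lintegral_intensityMeasure hΛ.measurable ω hBm, lintegral_eq_zero_of_ae_eq_zero]
    filter_upwards [ae_restrict_of_ae hnull] with v hv
    simp [hv]
  rw [lintegral_eq_zero_iff (hΛ.measurable_jump
    (F := fun p => N.indicator (1 : ℝ → ℝ≥0∞) (t - p.2)) (by fun_prop))] at hE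
  filter_upwards [hE] with ω hω
  refine ofReal_hawkesIntensity hμ hΦ h.zero (hH.countingPath ω) fun k hk hlt => ?_
  rw [lintegral_jumpMeasure] at hω
  have hzero := ENNReal.tsum_eq_zero.1 hω k
  rw [if_pos hk] at hzero
  by_contra hne
  have hmem : t - passageTime (fun r => H r ω) k ∈ N :=
    subset_toMeasurable _ _ fun himp => hne (himp (sub_pos.2 hlt))
  rw [indicator_of_mem hmem] at hzero
  exact one_ne_zero hzero

end IsHawkesProcess

end Representation

/-! ### Explicit moments and the main theorem. -/

section MomentFormulas

variable {Ω : Type*} {mΩ : MeasurableSpace Ω} {P : Measure Ω} [IsProbabilityMeasure P]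
  {ℱ : Filtration ℝ≥0 mΩ} {H : ℝ≥0 → Ω → ℕ} {μ : ℝ} {Φ : ℝ → ℝ} {φ : ℝ → ℝ≥0∞}

namespace HasPredictableIntensity

lemma lintegral_count {c : ℝ≥0∞} (hΛ : HasPredictableIntensity P ℱ H (hawkesRate c φ H))
    (h : IsBorelVersion Φ φ) (t : ℝ) :
    ∫⁻ ω, 0 + ∫⁻ v, (Iic t).indicator 1 v ∂(jumpMeasure fun r => H r ω) ∂P
      = c * ∫⁻ v in Ioc 0 t, renewalMass φ (t - v) := by
  simp_rw [zero_add]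
  rw [hΛ.lintegral_jump h.measurable h.zero h.lintegral_lt_one
    (measurable_one.indicator measurableSet_Iic) (T := t)
    (fun v hv => indicator_of_notMem (s := Iic t) (not_le.2 hv) _)]
  simp_rw [h.renewalTransform_indicator t]
  rw [setLIntegral_Ioi_eq_Ioc (s := t)
    (fun v hv => indicator_of_notMem (s := Iic t) (not_le.2 hv) _)]
  congr 1
  exact setLIntegral_congr_fun measurableSet_Ioc fun v hv => indicator_of_mem (s := Iic t) hv.2 _

lemma lintegral_rate {c : ℝ≥0∞} (hΛ : HasPredictableIntensity P ℱ H (hawkesRate c φ H))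
    (h : IsBorelVersion Φ φ) (t : ℝ) :
    ∫⁻ ω, c + ∫⁻ v, φ (t - v) ∂(jumpMeasure fun r => H r ω) ∂P = c * renewalMass φ t := by
  have hφ := h.measurable
  rw [lintegral_add_left measurable_const, lintegral_const, measure_univ, mul_one,
    hΛ.lintegral_jump hφ h.zero h.lintegral_lt_one (g := fun v => φ (t - v)) (by fun_prop) (T := t)
      (fun v hv => h.zero _ (by linarith))]
  simp_rw [renewalTransform_kernel hφ]
  rw [← renewalDensity_eq_renewalMass, renewalDensity, mul_add, mul_one]

end HasPredictableIntensity

/-- Strict positivity of `μ` is needed for the equivalence: with `μ = 0`, the product `0 * ∞ = 0`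
would hide an infinite integral. -/
lemma IsENNRealVersion.const_mul_setLIntegral {f : ℝ → ℝ} {K : ℝ → ℝ≥0∞} {s : ℝ} (hs : 0 ≤ s)
    (hf : IsENNRealVersion (volume.restrict (Ioc 0 s)) f K) (hμ : 0 < μ) :
    (ENNReal.ofReal μ * ∫⁻ v in Ioc 0 s, K v).toReal = μ * ∫ v in (0 : ℝ)..s, f v ∧
    (ENNReal.ofReal μ * ∫⁻ v in Ioc 0 s, K v ≠ ∞ ↔ IntervalIntegrable f volume 0 s) := by
  constructor
  · rw [ENNReal.toReal_mul, ENNReal.toReal_ofReal hμ.le, intervalIntegral.integral_of_le hs,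
      hf.integral_eq]
  · rw [intervalIntegrable_iff_integrableOn_Ioc_of_le hs, IntegrableOn, hf.integrable_iff]
    constructor
    · intro hne htop
      rw [htop, ENNReal.mul_top (ENNReal.ofReal_pos.2 hμ).ne'] at hne
      exact hne rfl
    · exact ENNReal.mul_ne_top ENNReal.ofReal_ne_top

/-- A single factor `ψ` is integrable, so the mixed covariances of process and intensity are always
finite; a product of two such factors need not be integrable. -/
lemma IsBorelVersion.setLIntegral_convResolvent_mul_ne_top (h : IsBorelVersion Φ φ) (s t : ℝ)
    {K : ℝ → ℝ≥0∞} {C : ℝ≥0∞} (hC : C ≠ ∞) (hK : ∀ v, K v ≤ C * convResolvent φ (t - v)) :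
    ∫⁻ v in Ioc 0 s, K v ≠ ∞ := by
  refine ne_top_of_le_ne_top ?_ ((lintegral_mono hK).trans (setLIntegral_le_lintegral _ _))
  rw [lintegral_const_mul' _ _ hC, lintegral_sub_left_eq_self]
  exact ENNReal.mul_ne_top hC (lintegral_convResolvent_lt_top h.measurable h.lintegral_lt_one).ne

end MomentFormulas

theorem theorem1 {Ω : Type*} {mΩ : MeasurableSpace Ω} (P : Measure Ω) [IsProbabilityMeasure P]
    (ℱ : Filtration ℝ≥0 mΩ) (μ : ℝ) (hμ : 0 < μ) (Φ : ℝ → ℝ) (hΦ : IsExcitationKernel Φ)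
    (H : ℝ≥0 → Ω → ℕ) (hH : IsHawkesProcess P ℱ μ Φ H)
    (Ψ : ℝ → ℝ) (hΨ : Ψ = hawkesPsi Φ)
    (X : ℝ≥0 → Ω → ℝ) (hX : X = fun t ω => (H t ω : ℝ))
    (lam : ℝ≥0 → Ω → ℝ) (hlam : lam = fun (t : ℝ≥0) ω => hawkesIntensity μ Φ H (t : ℝ) ω) :
    -- expectations
    (∀ t : ℝ≥0,
      (Integrable (X t) P ∧
        ∫ ω, X t ω ∂P = μ * ∫ u in (0 : ℝ)..t, (1 + ∫ r in (0 : ℝ)..u, Ψ r)) ∧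
      (Integrable (lam t) P ∧
        ∫ ω, lam t ω ∂P = μ * (1 + ∫ r in (0 : ℝ)..t, Ψ r))) ∧
    (∀ s t : ℝ≥0, s ≤ t →
      -- `Cov(H_s, H_t)`
      (Integrable (fun ω => X s ω * X t ω) P ∧
        covariance (X s) (X t) P
          = (∫ ω, X s ω * X t ω ∂P) - (∫ ω, X s ω ∂P) * (∫ ω, X t ω ∂P) ∧
        covariance (X s) (X t) P
          = μ * ∫ v in (0 : ℝ)..s, (1 + ∫ w in (0 : ℝ)..v, Ψ w) *
              (1 + ∫ y in v..s, Ψ (y - v)) * (1 + ∫ y in v..t, Ψ (y - v))) ∧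
      -- `Cov(λ_s, λ_t)`: the identity in `[0, ∞]`, where both sides may be infinite ...
      (∫⁻ ω, ENNReal.ofReal (lam s ω * lam t ω) ∂P
          = ENNReal.ofReal ((∫ ω, lam s ω ∂P) * (∫ ω, lam t ω ∂P)) +
            ENNReal.ofReal μ * ∫⁻ v in Ioc (0 : ℝ) s,
              ENNReal.ofReal (Ψ (s - v) * Ψ (t - v) * (1 + ∫ w in (0 : ℝ)..v, Ψ (v - w)))) ∧
      -- ... and between real numbers, when either side is finite
      (Integrable (fun ω => lam s ω * lam t ω) P ↔
        IntervalIntegrable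
          (fun v => Ψ (s - v) * Ψ (t - v) * (1 + ∫ w in (0 : ℝ)..v, Ψ (v - w))) volume 0 s) ∧
      (Integrable (fun ω => lam s ω * lam t ω) P →
        covariance (lam s) (lam t) P
          = (∫ ω, lam s ω * lam t ω ∂P) - (∫ ω, lam s ω ∂P) * (∫ ω, lam t ω ∂P) ∧
        covariance (lam s) (lam t) P
          = μ * ∫ v in (0 : ℝ)..s,
              Ψ (s - v) * Ψ (t - v) * (1 + ∫ w in (0 : ℝ)..v, Ψ (v - w))) ∧
      -- `Cov(λ_s, H_t)`
      (Integrable (fun ω => lam s ω * X t ω) P ∧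
        covariance (lam s) (X t) P
          = (∫ ω, lam s ω * X t ω ∂P) - (∫ ω, lam s ω ∂P) * (∫ ω, X t ω ∂P) ∧
        covariance (lam s) (X t) P
          = μ * ∫ v in (0 : ℝ)..s, Ψ (s - v) *
              (1 + ∫ w in (0 : ℝ)..v, Ψ w) * (1 + ∫ y in v..t, Ψ (y - v))) ∧
      -- `Cov(H_s, λ_t)`
      (Integrable (fun ω => X s ω * lam t ω) P ∧
        covariance (X s) (lam t) P
          = (∫ ω, X s ω * lam t ω ∂P) - (∫ ω, X s ω ∂P) * (∫ ω, lam t ω ∂P) ∧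
        covariance (X s) (lam t) P
          = μ * ∫ v in (0 : ℝ)..s, Ψ (t - v) *
              (1 + ∫ w in (0 : ℝ)..v, Ψ w) * (1 + ∫ y in v..s, Ψ (y - v)))) := by
  subst hΨ hX hlam
  obtain ⟨φ, h⟩ := hΦ.exists_isBorelVersion
  have hΦ0 := hΦ.nonneg
  have hφ := h.measurable
  have hΛ := hH.hasPredictableIntensity hμ.le hΦ0 h
  set c := ENNReal.ofReal μ with hc
  have hctop : c ≠ ∞ := ENNReal.ofReal_ne_top
  have hXv := hH.isENNRealVersion_process
  have hLv := fun t : ℝ => hH.isENNRealVersion_intensity hμ.le hΦ0 h t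
  set M := 1 + ∫⁻ z, convResolvent φ z with hM
  have hMtop : M ≠ ∞ := h.one_add_lintegral_convResolvent_ne_top
  have hmass : ∀ x, renewalMass φ x ≤ M := IsBorelVersion.renewalMass_le φ
  have hIoc : ∀ s : ℝ, volume (Ioc 0 s) ≠ ∞ := fun s => by simp
  have hEX : ∀ t : ℝ≥0, ∫⁻ ω, 0 + ∫⁻ v, (Iic (t : ℝ)).indicator 1 v
      ∂(jumpMeasure fun r => H r ω) ∂P ≠ ∞ := fun t => by
    rw [hΛ.lintegral_count h]
    refine ENNReal.mul_ne_top hctop (ne_top_of_le_ne_top ?_ (lintegral_mono fun v => hmass _))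
    rw [setLIntegral_const]
    exact ENNReal.mul_ne_top hMtop (hIoc _)
  have hEL : ∀ t : ℝ, ∫⁻ ω, c + ∫⁻ v, φ (t - v) ∂(jumpMeasure fun r => H r ω) ∂P ≠ ∞ :=
    fun t => by
      rw [hΛ.lintegral_rate h]
      exact ENNReal.mul_ne_top hctop (h.renewalMass_ne_top t)
  refine ⟨fun t => ⟨⟨(hXv t).integrable_iff.2 (hEX t), ?_⟩,
    (hLv t).integrable_iff.2 (hEL t), ?_⟩, fun s t hst => ?_⟩
  · rw [(hXv t).integral_eq, hΛ.lintegral_count h, ENNReal.toReal_mul, ENNReal.toReal_ofReal hμ.le,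
      ← (h.isENNRealVersion_renewalMass_sub hΦ0 le_rfl).integral_eq,
      ← intervalIntegral.integral_of_le t.coe_nonneg]
    simp_rw [intervalIntegral.integral_comp_sub_right, sub_self]
    -- The first moment formula produces the integrand at `t - v`; reflecting the interval gives the
    -- stated form.
    rw [intervalIntegral.integral_comp_sub_left
      (fun u => 1 + ∫ r in (0 : ℝ)..u, hawkesPsi Φ r) (t : ℝ), sub_self, sub_zero]
  · rw [(hLv t).integral_eq, hΛ.lintegral_rate h, ENNReal.toReal_mul, ENNReal.toReal_ofReal hμ.le,
      h.toReal_renewalMass hΦ0 t.coe_nonneg]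
  have hst' : (s : ℝ) ≤ t := hst
  have hs0 : (0 : ℝ) ≤ s := s.coe_nonneg
  have hind : ∀ x : ℝ≥0, x ≤ t → ∀ v : ℝ, (t : ℝ) < v →
      (Iic (x : ℝ)).indicator (1 : ℝ → ℝ≥0∞) v = 0 := fun x hx v hv =>
    indicator_of_notMem (s := Iic (x : ℝ)) (not_le.2 (lt_of_le_of_lt (by exact_mod_cast hx) hv)) _
  have hker : ∀ x : ℝ≥0, x ≤ t → ∀ v : ℝ, (t : ℝ) < v → φ (x - v) = 0 := fun x hx v hv => by
    have : (x : ℝ) ≤ t := hx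
    exact h.zero _ (by linarith)
  have hindm : ∀ x : ℝ, Measurable ((Iic x).indicator (1 : ℝ → ℝ≥0∞)) := fun x =>
    measurable_one.indicator measurableSet_Iic
  have hkerm : ∀ x : ℝ, Measurable fun v => φ (x - v) := fun x => by fun_prop
  have hz : ∀ v : ℝ, (s : ℝ) < v → convResolvent φ (s - v) = 0 := fun v hv =>
    convResolvent_of_nonpos h.zero (by linarith)
  have hzi : ∀ (f : ℝ → ℝ≥0∞) (v : ℝ), (s : ℝ) < v → (Iic (s : ℝ)).indicator f v = 0 :=
    fun f v hv => indicator_of_notMem (s := Iic (s : ℝ)) (not_le.2 hv) _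
  -- All four covariances are instances with horizon `t`: an indicator with constant `0` for the
  -- process, the shifted kernel with constant `c` for the intensity.
  have hmoment := fun {g k : ℝ → ℝ≥0∞} (hg : Measurable g) (hk : Measurable k)
      (hgT : ∀ v, (t : ℝ) < v → g v = 0) (hkT : ∀ v, (t : ℝ) < v → k v = 0) (d e : ℝ≥0∞) =>
    hΛ.lintegral_affine_mul_affine hφ h.zero h.lintegral_lt_one hctop hg hk hgT hkT d e
  have hρ := h.isENNRealVersion_renewalMass hΦ0 (s : ℝ)
  have hρs := h.isENNRealVersion_renewalMass_sub hΦ0 (le_refl (s : ℝ))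
  have hρt := h.isENNRealVersion_renewalMass_sub hΦ0 hst'
  have hψs := h.isENNRealVersion_hawkesPsi_sub hΦ0 (le_refl (s : ℝ))
  have hψt := h.isENNRealVersion_hawkesPsi_sub hΦ0 hst'
  -- `Cov(λ_s, λ_t)`
  have hLL : (∫⁻ ω, ENNReal.ofReal (hawkesIntensity μ Φ H s ω * hawkesIntensity μ Φ H t ω) ∂P
          = ENNReal.ofReal ((∫ ω, hawkesIntensity μ Φ H s ω ∂P) *
              (∫ ω, hawkesIntensity μ Φ H t ω ∂P)) +
            c * ∫⁻ v in Ioc (0 : ℝ) s, ENNReal.ofReal (hawkesPsi Φ (s - v) * hawkesPsi Φ (t - v) *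
              (1 + ∫ w in (0 : ℝ)..v, hawkesPsi Φ (v - w)))) ∧
      (Integrable (fun ω => hawkesIntensity μ Φ H s ω * hawkesIntensity μ Φ H t ω) P ↔
        IntervalIntegrable (fun v => hawkesPsi Φ (s - v) * hawkesPsi Φ (t - v) *
          (1 + ∫ w in (0 : ℝ)..v, hawkesPsi Φ (v - w))) volume 0 s) ∧
      (Integrable (fun ω => hawkesIntensity μ Φ H s ω * hawkesIntensity μ Φ H t ω) P →
        covariance (fun ω => hawkesIntensity μ Φ H s ω) (fun ω => hawkesIntensity μ Φ H t ω) P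
          = (∫ ω, hawkesIntensity μ Φ H s ω * hawkesIntensity μ Φ H t ω ∂P)
            - (∫ ω, hawkesIntensity μ Φ H s ω ∂P) * (∫ ω, hawkesIntensity μ Φ H t ω ∂P) ∧
        covariance (fun ω => hawkesIntensity μ Φ H s ω) (fun ω => hawkesIntensity μ Φ H t ω) P
          = μ * ∫ v in (0 : ℝ)..s, hawkesPsi Φ (s - v) * hawkesPsi Φ (t - v) *
              (1 + ∫ w in (0 : ℝ)..v, hawkesPsi Φ (v - w))) := by
    have hV := hmoment (hkerm s) (hkerm t) (hker s hst) (hker t le_rfl) c c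
    simp_rw [renewalTransform_kernel hφ, renewalDensity_eq_renewalMass] at hV
    rw [setLIntegral_Ioi_eq_Ioc (s := s) fun v hv => by rw [hz v hv, zero_mul, zero_mul]] at hV
    have hprod := (hψs.mul hψt).mul hρ
    have hval := hprod.const_mul_setLIntegral hs0 hμ
    have hrefl : ∀ v : ℝ, ∫ w in (0 : ℝ)..v, hawkesPsi Φ (v - w)
        = ∫ w in (0 : ℝ)..v, hawkesPsi Φ w := fun v => by
      rw [intervalIntegral.integral_comp_sub_left (hawkesPsi Φ) v, sub_self, sub_zero]
    simp_rw [hrefl]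
    obtain ⟨h1, h2, h3⟩ := (hLv s).covariance_eq (hLv t) (hEL s) (hEL t) hV
    refine ⟨?_, h2.trans hval.2, fun hint => ?_⟩
    · rw [hprod.lintegral_ofReal]
      exact h1
    · have h4 := h3 (h2.1 hint)
      exact ⟨h4.1, h4.2.trans hval.1⟩
  refine ⟨?_, hLL.1, hLL.2.1, hLL.2.2, ?_, ?_⟩
  · -- `Cov(H_s, H_t)`
    have hV := hmoment (hindm s) (hindm t) (hind s hst) (hind t le_rfl) 0 0
    simp_rw [h.renewalTransform_indicator, renewalDensity_eq_renewalMass] at hV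
    have hval := ((hρ.mul hρs).mul hρt).const_mul_setLIntegral hs0 hμ
    -- The transform of the weight attached to `s` vanishes beyond `s`, so only `(0, s]`
    -- contributes, and there the indicator at `t` is inactive.
    have hK : ∫⁻ v in Ioi (0 : ℝ), (Iic (s : ℝ)).indicator (fun v => renewalMass φ (s - v)) v *
        (Iic (t : ℝ)).indicator (fun v => renewalMass φ (t - v)) v * renewalMass φ v
        = ∫⁻ v in Ioc 0 (s : ℝ), renewalMass φ v * renewalMass φ (s - v) * renewalMass φ (t - v) := by
      rw [setLIntegral_Ioi_eq_Ioc (s := s) fun v hv => by rw [hzi _ v hv, zero_mul, zero_mul]]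
      refine setLIntegral_congr_fun measurableSet_Ioc fun v hv => ?_
      rw [indicator_of_mem (s := Iic (s : ℝ)) hv.2,
        indicator_of_mem (s := Iic (t : ℝ)) (hv.2.trans hst')]
      ring
    rw [hK] at hV
    have hne : c * ∫⁻ v in Ioc 0 (s : ℝ),
        renewalMass φ v * renewalMass φ (s - v) * renewalMass φ (t - v) ≠ ∞ := by
      refine ENNReal.mul_ne_top hctop (ne_top_of_le_ne_top ?_ (lintegral_mono fun v =>
        mul_le_mul' (mul_le_mul' (hmass _) (hmass _)) (hmass _)))
      rw [setLIntegral_const]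
      exact ENNReal.mul_ne_top (ENNReal.mul_ne_top (ENNReal.mul_ne_top hMtop hMtop) hMtop) (hIoc _)
    obtain ⟨-, h2, h3⟩ := (hXv s).covariance_eq (hXv t) (hEX s) (hEX t) hV
    exact ⟨h2.2 hne, (h3 hne).1, (h3 hne).2.trans hval.1⟩
  · -- `Cov(λ_s, H_t)`
    have hV := hmoment (hkerm s) (hindm t) (hker s hst) (hind t le_rfl) c 0
    simp_rw [renewalTransform_kernel hφ, h.renewalTransform_indicator,
      renewalDensity_eq_renewalMass] at hV
    have hval := ((hψs.mul hρ).mul hρt).const_mul_setLIntegral hs0 hμ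
    have hK : ∫⁻ v in Ioi (0 : ℝ), convResolvent φ (s - v) *
        (Iic (t : ℝ)).indicator (fun v => renewalMass φ (t - v)) v * renewalMass φ v
        = ∫⁻ v in Ioc 0 (s : ℝ),
            convResolvent φ (s - v) * renewalMass φ v * renewalMass φ (t - v) := by
      rw [setLIntegral_Ioi_eq_Ioc (s := s) fun v hv => by rw [hz v hv, zero_mul, zero_mul]]
      refine setLIntegral_congr_fun measurableSet_Ioc fun v hv => ?_
      rw [indicator_of_mem (s := Iic (t : ℝ)) (hv.2.trans hst')]
      ring
    rw [hK] at hV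
    have hne : c * ∫⁻ v in Ioc 0 (s : ℝ),
        convResolvent φ (s - v) * renewalMass φ v * renewalMass φ (t - v) ≠ ∞ :=
      ENNReal.mul_ne_top hctop (h.setLIntegral_convResolvent_mul_ne_top s s
        (ENNReal.mul_ne_top hMtop hMtop) fun v =>
          (mul_le_mul' (mul_le_mul' le_rfl (hmass _)) (hmass _)).trans_eq (by ring))
    obtain ⟨-, h2, h3⟩ := (hLv s).covariance_eq (hXv t) (hEL s) (hEX t) hV
    exact ⟨h2.2 hne, (h3 hne).1, (h3 hne).2.trans hval.1⟩
  · -- `Cov(H_s, λ_t)`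
    have hV := hmoment (hindm s) (hkerm t) (hind s hst) (hker t le_rfl) 0 c
    simp_rw [renewalTransform_kernel hφ, h.renewalTransform_indicator,
      renewalDensity_eq_renewalMass] at hV
    have hval := ((hψt.mul hρ).mul hρs).const_mul_setLIntegral hs0 hμ
    have hK : ∫⁻ v in Ioi (0 : ℝ), (Iic (s : ℝ)).indicator (fun v => renewalMass φ (s - v)) v *
        convResolvent φ (t - v) * renewalMass φ v
        = ∫⁻ v in Ioc 0 (s : ℝ),
            convResolvent φ (t - v) * renewalMass φ v * renewalMass φ (s - v) := by
      rw [setLIntegral_Ioi_eq_Ioc (s := s) fun v hv => by rw [hzi _ v hv, zero_mul, zero_mul]]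
      refine setLIntegral_congr_fun measurableSet_Ioc fun v hv => ?_
      rw [indicator_of_mem (s := Iic (s : ℝ)) hv.2]
      ring
    rw [hK] at hV
    have hne : c * ∫⁻ v in Ioc 0 (s : ℝ),
        convResolvent φ (t - v) * renewalMass φ v * renewalMass φ (s - v) ≠ ∞ :=
      ENNReal.mul_ne_top hctop (h.setLIntegral_convResolvent_mul_ne_top s t
        (ENNReal.mul_ne_top hMtop hMtop) fun v =>
          (mul_le_mul' (mul_le_mul' le_rfl (hmass _)) (hmass _)).trans_eq (by ring))
    obtain ⟨-, h2, h3⟩ := (hXv s).covariance_eq (hLv t) (hEX s) (hEL t) hV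
    exact ⟨h2.2 hne, (h3 hne).1, (h3 hne).2.trans hval.1⟩
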